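/- Let $\mathfrak g$ be a finite-dimensional simple complex Lie algebra with Cartan subalgebra $\mathfrak h$, root system $\Delta$ and Weyl group $W$. Fix simple roots $\alpha_1,\dots,\alpha_n$, with positive roots $\Delta^+$, Borel subalgebra $\mathfrak b=\mathfrak h\oplus\mathfrak n$, $\mathfrak n=\bigoplus_{\alpha\in\Delta^+}\mathfrak g_\alpha$, highest root $\theta$ and Coxeter number $h$. Let $\mathfrak h_{\mathbb R}$ be the real span of the coroots, $Q^\vee$ the coroot lattice, $P^\vee=\{x\in\mathfrak h_{\mathbb R}: (x,\alpha)\in\mathbb Z\ \forall\alpha\in\Delta\}$, $\widehat W=W\ltimes T(Q^\vee)$ the affine Weyl group ($T(Q^\vee)$ being the translations $t_\tau$, $\tau\in Q^\vee$), and $\overline C_k=\{x\in\mathfrak h_{\mathbb R}: (x,\alpha_i)\ge 0\ \forall i,\ (x,\theta)\le k\}$. Regard the affine roots $\alpha+k\delta$ ($\alpha\in\Delta$, $k\in\mathbb Z$) as the affine functions $x\mapsto(\alpha,x)+k$, with $w\in\widehat W$ acting by $a\mapsto a\circ w^{-1}$. Such a root is positive if $\alpha>0$, $k\ge0$ or $\alpha<0$,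 $k\ge1$, and negative otherwise. Let $N(w)$ be the set of positive affine roots $a$ with $w^{-1}(a)<0$, and for $v\in W$ let $N(v)=\{\alpha\in\Delta^+: v^{-1}(\alpha)<0\}$. For an ideal $\mathfrak i$ of $\mathfrak b$ contained in $\mathfrak n$ put $\Phi_{\mathfrak i}=\{\alpha\in\Delta^+:\mathfrak g_\alpha\subseteq\mathfrak i\}$ and $L_{\mathfrak i}=\bigcup_{k\ge1}(-\Phi_{\mathfrak i}^k+k\delta)$, where $\Phi^1=\Phi$ and $\Phi^{k+1}=(\Phi^{k}+\Phi)\cap\Delta$. Let $z\in\widetilde Z_{ab}=\{\sigma\in P^\vee: (\sigma,\beta)\in\{0,1,-1,-2\}\ \forall\beta\in\Delta^+\}$ and put $\Delta_z^i=\{\alpha\in\Delta^+: (\alpha,z)=i\}$. Then there are a unique $v_z\in W$ with $v_z^{-1}(z+\overline C_1)\subseteq\overline C_h$, a unique $w\in\widehat W$ with $v_z^{-1}(z+\overline C_1)=w(\overline C_1)$, and a unique ideal $\mathfrak i_z$ of $\mathfrak b$ contained in $\mathfrak n$ with $L_{\mathfrak i_z}=N(w)$. Moreover $N(v_z)=\Delta_z^{-2}\cup\Delta_z^{-1}$,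 the ideal $\mathfrak i_z$ is abelian, and $$\Phi_{\mathfrak i_z}=-v_z^{-1}(\Delta_z^{-2})\cup v_z^{-1}(\Delta_z^{1}),\qquad \mathfrak i_z=\bigoplus_{\alpha\in -v_z^{-1}(\Delta_z^{-2})\cup v_z^{-1}(\Delta_z^{1})}\mathfrak g_\alpha .$$ -/

import Mathlib

noncomputable section

namespace AffineIdeals

section RootSystem

variable {ι M N : Type*} [AddCommGroup M] [Module ℝ M] [AddCommGroup N] [Module ℝ N]
  {P : RootPairing ι ℝ M N}

/-- The action of the finite Weyl group on the space `N` of the coroots, dual to its action on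
the space `M` of the roots (see `toLinearMap_smul_coweightAct`). The inverse is there because
`coweightEquiv` is contravariant. -/
def coweightAct (v : P.weylGroup) : N ≃ₗ[ℝ] N :=
  RootPairing.Equiv.coweightEquiv P P ((v⁻¹ : P.weylGroup) : P.Aut)

lemma toLinearMap_smul_coweightAct (v : P.weylGroup) (m : M) (x : N) :
    P.toLinearMap (v • m) (coweightAct v x) = P.toLinearMap m x := by
  have h := LinearMap.congr_fun (LinearMap.congr_fun
    ((v⁻¹ : P.weylGroup) : P.Aut).weight_coweight_transpose x) (v • m)
  have h2 : ((v⁻¹ : P.weylGroup) : P.Aut).weightMap (v • m) = m := inv_smul_smul v m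
  simp only [LinearMap.coe_comp, Function.comp_apply, LinearMap.dualMap_apply,
    h2] at h
  exact h.symm

/-- The coweight lattice `P^∨`: the points on which all roots take integral values. -/
def coweightLattice (P : RootPairing ι ℝ M N) : Set N :=
  {x | ∀ i, ∃ n : ℤ, P.toLinearMap (P.root i) x = n}

/-- `Δ_z^k`: the positive roots `α` with `(α, z) = k`. -/
def level (b : P.Base) (z : N) (k : ℤ) : Set ι :=
  {i | b.IsPos i ∧ P.toLinearMap (P.root i) z = k}

/-- The set `Z̃_ab`: the `z ∈ P^∨` with `(z, β) ∈ {0, -1, 1, -2}` for all `β > 0`. -/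
def zTildeAb (b : P.Base) : Set N :=
  {z | z ∈ coweightLattice P ∧
    ∀ i, b.IsPos i → P.toLinearMap (P.root i) z ∈ ({0, -1, 1, -2} : Set ℝ)}

/-- The set `-S` for a set `S` of roots. -/
def negRoots (P : RootPairing ι ℝ M N) (S : Set ι) : Set ι :=
  {i | ∃ j ∈ S, P.root i = -P.root j}

/-- A highest root: a maximal element for the order in which `α ≤ β` means that `β - α` is a sum
of simple roots. An irreducible reduced crystallographic root system has exactly one. -/
def IsHighestRoot (b : P.Base) (θ : ι) : Prop :=
  ∀ j, P.root j - P.root θ ∈ AddSubmonoid.closure (P.root '' b.support) → j = θ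

/-- The closed alcove `C̄_k`, cut out by `(x, α) ≥ 0` for all simple `α` and by `(x, θ) ≤ k`. -/
def closedAlcove (b : P.Base) (k : ℤ) : Set N :=
  {x | (∀ i ∈ b.support, 0 ≤ P.toLinearMap (P.root i) x) ∧
    ∀ θ, IsHighestRoot b θ → P.toLinearMap (P.root θ) x ≤ k}

/-- The Coxeter number: one plus the height of the highest root. -/
def coxeterNumber (b : P.Base) : ℤ :=
  1 + sSup (Set.range b.height)

/-- `N(v)` for `v` in the finite Weyl group: the `α > 0` with `v⁻¹(α) < 0`. -/
def inversions (b : P.Base) (v : P.weylGroup) : Set ι :=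
  {i | b.IsPos i ∧ ¬ b.IsPos (v⁻¹ • i)}

/-- The affine Weyl group `W ⋉ T(Q^∨)`, as the set of the affine maps `t_τ v` with `v ∈ W` and
`τ` in the coroot lattice `Q^∨`. -/
def affineWeylGroup (P : RootPairing ι ℝ M N) : Set (N ≃ᵃ[ℝ] N) :=
  {w | ∃ τ ∈ P.corootSpan ℤ, ∃ v : P.weylGroup, ∀ x, w x = coweightAct v x + τ}

/-- The affine root `α + kδ`, encoded by the pair of (the index of) `α` and `k`, as an affine
function: `x ↦ (α, x) + k`. -/
def affineRootFun (P : RootPairing ι ℝ M N) (a : ι × ℤ) (x : N) : ℝ :=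
  P.toLinearMap (P.root a.1) x + a.2

/-- The positive affine roots: `α + kδ` with `α > 0`, `k ≥ 0` or with `α < 0`, `k ≥ 1`. Every
other affine root is negative. -/
def IsAffinePos (b : P.Base) (a : ι × ℤ) : Prop :=
  (b.IsPos a.1 ∧ 0 ≤ a.2) ∨ (¬ b.IsPos a.1 ∧ 1 ≤ a.2)

/-- `N(w)` for an affine map `w`: the positive affine roots `a` for which `w⁻¹(a)`, that is
`a ∘ w` as a function, is a negative affine root. -/
def affineInversions (b : P.Base) (w : N ≃ᵃ[ℝ] N) : Set (ι × ℤ) :=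
  {a | IsAffinePos b a ∧ ∃ c : ι × ℤ, ¬ IsAffinePos b c ∧
    ∀ x, affineRootFun P c x = affineRootFun P a (w x)}

/-- `rootPow P Φ n` is `Φ^{n+1}`, where `Φ^1 = Φ` and `Φ^{k+1} = (Φ^k + Φ) ∩ Δ`. -/
def rootPow (P : RootPairing ι ℝ M N) (Φ : Set ι) : ℕ → Set ι
  | 0 => Φ
  | n + 1 => {i | ∃ j ∈ rootPow P Φ n, ∃ l ∈ Φ, P.root i = P.root j + P.root l}

/-- The set `⋃_{k ≥ 1} (-Φ^k + kδ)` of affine roots. -/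
def affineSet (P : RootPairing ι ℝ M N) (Φ : Set ι) : Set (ι × ℤ) :=
  {a | ∃ n : ℕ, a.1 ∈ negRoots P (rootPow P Φ n) ∧ a.2 = (n : ℤ) + 1}

/-- `v` is the element `v_z` of the finite Weyl group: `v⁻¹(z + C̄_1) ⊆ C̄_h`. -/
def IsFinitePart (b : P.Base) (z : N) (v : P.weylGroup) : Prop :=
  ∀ y ∈ closedAlcove b 1, coweightAct v⁻¹ (z + y) ∈ closedAlcove b (coxeterNumber b)

/-- `w` is the element of the affine Weyl group with `v⁻¹(z + C̄_1) = w(C̄_1)`, for `v = v_z`. -/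
def IsAffinePart (b : P.Base) (z : N) (v : P.weylGroup) (w : N ≃ᵃ[ℝ] N) : Prop :=
  w ∈ affineWeylGroup P ∧
    (fun y => coweightAct v⁻¹ (z + y)) '' closedAlcove b 1 = w '' closedAlcove b 1

end RootSystem

section LieAlgebra

open LieAlgebra

variable {L : Type*} [LieRing L] [LieAlgebra ℂ L] [FiniteDimensional ℂ L]
  [LieAlgebra.IsSimple ℂ L] (H : LieSubalgebra ℂ L) [H.IsCartanSubalgebra]

/-- The real form `𝔥_ℝ` of the Cartan subalgebra: the real span of the coroots. -/
abbrev hReal : Submodule ℝ H :=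
  Submodule.span ℝ (Set.range (IsKilling.rootSystem H).coroot)

/-- The real span `𝔥_ℝ^*` of the roots. -/
abbrev hRealDual : Submodule ℝ (Module.Dual ℂ H) :=
  Submodule.span ℝ (Set.range (IsKilling.rootSystem H).root)

/-- The root system `Δ` of `(𝔤, 𝔥)`, as a real root system in `𝔥_ℝ^*`. -/
abbrev realRootSystem : RootPairing H.root ℝ (hRealDual H) (hReal H) :=
  (IsKilling.rootSystem H).restrictScalars ℝ

variable {H} (b : (realRootSystem H).Base)

/-- `𝔦(Φ)`: the sum of the root spaces `𝔤_α`, `α ∈ Φ`. -/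
def rootSpaceSum (Φ : Set H.root) : Submodule ℂ L :=
  ⨆ α ∈ Φ, (rootSpace H α.1).toSubmodule

/-- The nilradical `𝔫` of the Borel subalgebra: the sum of the positive root spaces. -/
def nilradical : Submodule ℂ L :=
  rootSpaceSum {α | b.IsPos α}

variable {b} in
lemma lie_mem_nilradical {α : H.root} (hα : b.IsPos α) {χ : H → ℂ}
    (hχ : χ = 0 ∨ ∃ β : H.root, b.IsPos β ∧ χ = β.1) {x y : L}
    (hx : x ∈ rootSpace H α.1) (hy : y ∈ rootSpace H χ) : ⁅x, y⁆ ∈ nilradical b := by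
  have hmem : ∀ γ : H.root, b.IsPos γ → ∀ u ∈ rootSpace H γ.1, u ∈ nilradical b := by
    intro γ hγ u hu
    exact Submodule.mem_iSup_of_mem γ (Submodule.mem_iSup_of_mem hγ hu)
  have h := lie_mem_genWeightSpace_of_mem_genWeightSpace hx hy
  rcases hχ with rfl | ⟨β, hβ, rfl⟩
  · rw [add_zero] at h
    exact hmem α hα _ h
  · by_cases h0 : ⁅x, y⁆ = 0
    · rw [h0]
      exact zero_mem _
    have hne : LieModule.genWeightSpace L ((α.1 : H → ℂ) + (β.1 : H → ℂ)) ≠ ⊥ := by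
      intro hbot
      rw [hbot] at h
      exact h0 (by simpa using h)
    let γ : LieModule.Weight ℂ H L := ⟨_, hne⟩
    by_cases hγ : γ.IsZero
    · exfalso
      have hsum : (realRootSystem H).root α = -(realRootSystem H).root β := by
        rw [eq_neg_iff_add_eq_zero]
        ext u
        exact congrFun hγ u
      let _ := (realRootSystem H).indexNeg
      have hidx : α = -β := by
        apply (realRootSystem H).root.injective
        rw [hsum, RootPairing.indexNeg_neg, RootPairing.root_reflectionPerm,
          RootPairing.reflection_apply_self]
      rw [hidx, RootPairing.Base.IsPos.neg_iff_not] at hα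
      exact hα hβ
    · have hγ' : γ ∈ H.root := by simpa using hγ
      refine hmem ⟨γ, hγ'⟩ ?_ _ h
      refine hα.add hβ ?_
      ext u
      rfl

lemma lie_mem_sup_nilradical {x y : L} (hx : x ∈ H.toSubmodule ⊔ nilradical b)
    (hy : y ∈ H.toSubmodule ⊔ nilradical b) : ⁅x, y⁆ ∈ H.toSubmodule ⊔ nilradical b := by
  have key : ∀ α : H.root, b.IsPos α → ∀ u ∈ rootSpace H α.1,
      ∀ v ∈ H.toSubmodule ⊔ nilradical b, ⁅u, v⁆ ∈ nilradical b := by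
    intro α hα u hu v hv
    obtain ⟨s, hs, t, ht, rfl⟩ := Submodule.mem_sup.mp hv
    rw [lie_add]
    refine add_mem (lie_mem_nilradical hα (Or.inl rfl) hu ?_) ?_
    · rw [LieAlgebra.rootSpace_zero_eq ℂ L H]
      exact hs
    · refine Submodule.iSup_induction (fun β : H.root => ⨆ _ : β ∈ {α | b.IsPos α},
        (rootSpace H β.1).toSubmodule) (motive := fun t => ⁅u, t⁆ ∈ nilradical b) ht ?_ ?_ ?_
      · intro β w hw
        by_cases hβ : b.IsPos β
        · exact lie_mem_nilradical hα (Or.inr ⟨β, hβ, rfl⟩) hu (by simpa [hβ] using hw)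
        · have : w = 0 := by simpa [hβ] using hw
          rw [this, lie_zero]
          exact zero_mem _
      · rw [lie_zero]
        exact zero_mem _
      · intro p q hp hq
        rw [lie_add]
        exact add_mem hp hq
  have key2 : ∀ u ∈ nilradical b, ∀ v ∈ H.toSubmodule ⊔ nilradical b,
      ⁅u, v⁆ ∈ nilradical b := by
    intro u hu v hv
    refine Submodule.iSup_induction (fun β : H.root => ⨆ _ : β ∈ {α | b.IsPos α},
        (rootSpace H β.1).toSubmodule) (motive := fun t => ⁅t, v⁆ ∈ nilradical b) hu ?_ ?_ ?_
    · intro β w hw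
      by_cases hβ : b.IsPos β
      · exact key β hβ w (by simpa [hβ] using hw) v hv
      · have : w = 0 := by simpa [hβ] using hw
        rw [this, zero_lie]
        exact zero_mem _
    · rw [zero_lie]
      exact zero_mem _
    · intro p q hp hq
      rw [add_lie]
      exact add_mem hp hq
  obtain ⟨s, hs, t, ht, rfl⟩ := Submodule.mem_sup.mp hx
  obtain ⟨s', hs', t', ht', rfl⟩ := Submodule.mem_sup.mp hy
  rw [add_lie, lie_add]
  refine add_mem (add_mem ?_ ?_) (Submodule.mem_sup_right (key2 t ht _ hy))
  · exact Submodule.mem_sup_left (H.lie_mem hs hs')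
  · rw [← lie_skew]
    exact Submodule.mem_sup_right (neg_mem (key2 t' ht' s (Submodule.mem_sup_left hs)))

/-- The Borel subalgebra `𝔟 = 𝔥 ⊕ 𝔫` of the positive system given by `b`. -/
def borelSubalgebra : LieSubalgebra ℂ L where
  __ := H.toSubmodule ⊔ nilradical b
  lie_mem' := lie_mem_sup_nilradical b

variable {b}

/-- An ideal of `𝔟`, as a subspace of `𝔤`. -/
def toSubspace (I : LieIdeal ℂ (borelSubalgebra b)) : Submodule ℂ L :=
  I.toSubmodule.map (borelSubalgebra b).toSubmodule.subtype

/-- `Φ_𝔦`: the positive roots `α` with `𝔤_α ⊆ 𝔦`. -/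
def idealRoots (I : LieIdeal ℂ (borelSubalgebra b)) : Set H.root :=
  {α | b.IsPos α ∧ (rootSpace H α.1).toSubmodule ≤ toSubspace I}

/-- `I` is the ideal attached to the affine Weyl group element `w`: the ad-nilpotent ideal
(an ideal of `𝔟` contained in `𝔫`) with `⋃_{k ≥ 1} (-Φ_I^k + kδ) = N(w)`. -/
def IsIdealOf (w : hReal H ≃ᵃ[ℝ] hReal H) (I : LieIdeal ℂ (borelSubalgebra b)) : Prop :=
  toSubspace I ≤ nilradical b ∧
    affineSet (realRootSystem H) (idealRoots I) = affineInversions b w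

end LieAlgebra

end AffineIdeals

end

open AffineIdeals

noncomputable section

namespace AffineIdeals

/-! ### Positive roots, heights and highest roots. -/

section Positive

variable {ι M N : Type*} [AddCommGroup M] [Module ℝ M] [AddCommGroup N] [Module ℝ N]
  {P : RootPairing ι ℝ M N} (b : P.Base)

/-! Fix y in the open fundamental alcove and consider the single point X = v⁻¹(z + y). Since roots
are integral at z, while (α, y) lies strictly between 0 and 1 for α > 0, no affine root vanishes at
z + y. Positivity of an affine root is read off at one interior point of the alcove
(`isAffinePos_iff`), so each condition in the theorem becomes an inequality at X.

The element v_z is the one that makes X dominant. The bound by h costs nothing: roots are at most 2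
on z + C̄_1, and h ≥ 2 (`isFinitePart_iff`). The element w is the one that carries an interior point
of C̄_1 to X. Although z need not lie in Q^∨, the map x ↦ v⁻¹(z + x) still permutes the affine
roots, so the two alcoves containing X coincide (`image_translate_eq`).

Membership of z in Z̃_ab makes every root less than 2 at z + y. Hence the inversions of w are
exactly the -α + δ with (α, X) > 1. The set Φ of these α absorbs positive roots because X is
dominant, and no two of its elements add up to a root, since the sum would exceed 2 at X. This gives
both commutativity and Φ² = ∅, so that L = N(w) (`affineSet_eq_iff`). Sorting the roots by their
value at z yields the formula for Φ (`rootsGtOne_eq`).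

Uniqueness of v and w rests on the deletion argument for the group generated by the simple affine
reflections (`eq_one_of_forall_isAffinePos`). Uniqueness of the ideal holds because an ideal of 𝔟
inside 𝔫 is a sum of root spaces (`toSubspace_eq_rootSpaceSum`). -/

lemma root_neg (P : RootPairing ι ℝ M N) (i : ι) :
    P.root (P.reflectionPerm i i) = -P.root i := by
  rw [RootPairing.root_reflectionPerm, RootPairing.reflection_apply_self]

lemma isPos_neg_iff (i : ι) : b.IsPos (P.reflectionPerm i i) ↔ ¬ b.IsPos i :=
  RootPairing.Base.IsPos.neg_iff_not b i

/-- A point of `N` on which all simple roots take the value one. -/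
lemma exists_height_eq [P.IsRootSystem] :
    ∃ c : N, ∀ i, P.toLinearMap (P.root i) c = b.height i := by
  let f : M →ₗ[ℝ] ℝ := b.toWeightBasis.constr ℝ (fun _ => (1 : ℝ))
  have hf : ∀ j ∈ b.support, f (P.root j) = 1 := by
    intro j hj
    have := b.toWeightBasis.constr_basis ℝ (fun _ => (1 : ℝ)) ⟨j, hj⟩
    rwa [RootPairing.Base.toWeightBasis_apply] at this
  refine ⟨P.flip.toPerfPair.symm f, fun i => ?_⟩
  have h1 : P.toLinearMap (P.root i) (P.flip.toPerfPair.symm f) = f (P.root i) := by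
    simp
  rw [h1]
  obtain ⟨g, -, -, hg⟩ := b.exists_root_eq_sum_int i
  rw [RootPairing.Base.height_eq_sum hg, hg, map_sum, Int.cast_sum]
  refine Finset.sum_congr rfl fun j hj => ?_
  rw [map_zsmul, hf j hj, zsmul_one]

variable {b} in
lemma map_nonneg_of_mem_closure {f : M →ₗ[ℝ] ℝ} (hf : ∀ i ∈ b.support, 0 ≤ f (P.root i)) {m : M}
    (hm : m ∈ AddSubmonoid.closure (P.root '' b.support)) : 0 ≤ f m := by
  induction hm using AddSubmonoid.closure_induction with
  | mem x hx =>
    obtain ⟨i, hi, rfl⟩ := hx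
    exact hf i hi
  | zero => simp
  | add x y _ _ hx hy => rw [map_add]; exact add_nonneg hx hy

variable {b} in
lemma eq_zero_or_map_pos_of_mem_closure {f : M →ₗ[ℝ] ℝ} (hf : ∀ i ∈ b.support, 0 < f (P.root i))
    {m : M} (hm : m ∈ AddSubmonoid.closure (P.root '' b.support)) : m = 0 ∨ 0 < f m := by
  induction hm using AddSubmonoid.closure_induction with
  | mem x hx =>
    obtain ⟨i, hi, rfl⟩ := hx
    exact Or.inr (hf i hi)
  | zero => simp
  | add x y _ _ hx hy =>
    rcases hx with rfl | hx
    · simpa using hy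
    · rcases hy with rfl | hy
      · simpa using Or.inr hx
      · rw [map_add]
        exact Or.inr (add_pos hx hy)

/-- Positivity means positive height. A root or its negative is a sum of simple roots, and height is
nonnegative on such sums, so the sign of the height decides which. -/
lemma isPos_iff_mem_closure [P.IsRootSystem] (i : ι) :
    b.IsPos i ↔ P.root i ∈ AddSubmonoid.closure (P.root '' b.support) := by
  obtain ⟨c, hc⟩ := exists_height_eq b
  have key : ∀ j, P.root j ∈ AddSubmonoid.closure (P.root '' b.support) → b.IsPos j := by
    intro j hj
    have : 0 ≤ P.toLinearMap.flip c (P.root j) := by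
      refine map_nonneg_of_mem_closure (fun k hk => ?_) hj
      rw [LinearMap.flip_apply, hc, RootPairing.Base.height_one_of_mem_support hk]
      norm_num
    rw [LinearMap.flip_apply, hc] at this
    rw [RootPairing.Base.isPos_iff']
    exact_mod_cast this
  refine ⟨fun h => (b.root_mem_or_neg_mem i).resolve_right fun h' => ?_, key i⟩
  rw [← root_neg] at h'
  exact (isPos_neg_iff b i).mp (key _ h') h

variable {b}

lemma pos_of_isPos [P.IsRootSystem] {f : M →ₗ[ℝ] ℝ} (hf : ∀ i ∈ b.support, 0 < f (P.root i)) {i : ι}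
    (hi : b.IsPos i) : 0 < f (P.root i) :=
  (eq_zero_or_map_pos_of_mem_closure hf ((isPos_iff_mem_closure b i).mp hi)).resolve_left
    (P.ne_zero i)

/-- Among the roots above i, one of maximal height is maximal in the order. With this, neither
irreducibility nor uniqueness of the highest root is needed. -/
lemma exists_isHighestRoot_ge [P.IsRootSystem] [Finite ι] (i : ι) :
    ∃ θ, IsHighestRoot b θ ∧
      P.root θ - P.root i ∈ AddSubmonoid.closure (P.root '' b.support) := by
  obtain ⟨c, hc⟩ := exists_height_eq b
  obtain ⟨θ, hθ, hmax⟩ := Set.exists_max_image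
    {j | P.root j - P.root i ∈ AddSubmonoid.closure (P.root '' b.support)} b.height
    (Set.toFinite _) ⟨i, by simp⟩
  refine ⟨θ, fun j hj => ?_, hθ⟩
  have hji : P.root j - P.root i ∈ AddSubmonoid.closure (P.root '' b.support) := by
    have := add_mem hj hθ
    simpa using this
  have h1 := hmax j hji
  have h2 := eq_zero_or_map_pos_of_mem_closure (f := P.toLinearMap.flip c) (fun k hk => by
    rw [LinearMap.flip_apply, hc, RootPairing.Base.height_one_of_mem_support hk]
    norm_num) hj
  rcases h2 with h2 | h2
  · exact P.root.injective (sub_eq_zero.mp h2)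
  · rw [map_sub, LinearMap.flip_apply, LinearMap.flip_apply, hc, hc, sub_pos] at h2
    exact absurd h1 (not_le.mpr (by exact_mod_cast h2))

lemma IsHighestRoot.isPos [P.IsRootSystem] {θ : ι} (hθ : IsHighestRoot b θ) : b.IsPos θ := by
  by_contra h
  have hneg := (isPos_neg_iff b θ).mpr h
  have hmem := (isPos_iff_mem_closure b _).mp hneg
  have heq := hθ (P.reflectionPerm θ θ) (by
    have := add_mem hmem hmem
    rw [root_neg, ← sub_eq_add_neg] at this
    rwa [root_neg])
  exact h (heq ▸ hneg)

lemma IsHighestRoot.root_add_ne [P.IsRootSystem] {θ i : ι} (hθ : IsHighestRoot b θ)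
    (hi : b.IsPos i) (k : ι) : P.root k ≠ P.root θ + P.root i := by
  intro hk
  have hkθ : k = θ := hθ k (by
    rw [hk, add_sub_cancel_left]
    exact (isPos_iff_mem_closure b i).mp hi)
  rw [hkθ, left_eq_add] at hk
  exact P.ne_zero i hk

variable [P.IsCrystallographic]

lemma IsHighestRoot.pairingIn_nonneg [P.IsRootSystem] [Finite ι] {θ i : ι} (hθ : IsHighestRoot b θ)
    (hi : b.IsPos i) : 0 ≤ P.pairingIn ℤ i θ := by
  by_contra! h
  by_cases h' : P.root i = -P.root θ
  · rw [← root_neg] at h'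
    rw [P.root.injective h', isPos_neg_iff] at hi
    exact hi hθ.isPos
  · obtain ⟨k, hk⟩ := P.root_add_root_mem_of_pairingIn_neg h h'
    exact hθ.root_add_ne hi k (by rw [hk, add_comm])

lemma root_reflectionPerm_eq (i j : ι) :
    P.root (P.reflectionPerm i j) = P.root j - P.pairingIn ℤ j i • P.root i := by
  rw [RootPairing.root_reflectionPerm, RootPairing.reflection_apply_root' ℤ]

/-- If the pairing is positive, θ - i is a positive root, and its own pairing 2 - ⟨i, θ^∨⟩ is
nonnegative. The value 2 is impossible, for then 2θ - i = θ + (θ - i) would be a root above θ. This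
controls the reflection in -θ + δ. -/
lemma IsHighestRoot.pairingIn_eq [P.IsRootSystem] [Finite ι] {θ i : ι} (hθ : IsHighestRoot b θ)
    (hi : b.IsPos i) (hne : i ≠ θ) :
    P.pairingIn ℤ i θ = 0 ∨
      P.pairingIn ℤ i θ = 1 ∧ ¬ b.IsPos (P.reflectionPerm θ i) := by
  rcases (hθ.pairingIn_nonneg hi).eq_or_lt with h0 | h0
  · exact Or.inl h0.symm
  right
  obtain ⟨k, hk⟩ := P.root_sub_root_mem_of_pairingIn_pos h0 hne
  have hkneg : ¬ b.IsPos k := fun hpos =>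
    hθ.root_add_ne hpos i (by rw [hk]; abel)
  have hnk : b.IsPos (P.reflectionPerm k k) := (isPos_neg_iff b k).mpr hkneg
  have hpair : P.pairingIn ℤ (P.reflectionPerm k k) θ = 2 - P.pairingIn ℤ i θ := by
    have h1 := P.pairingIn_eq_add_of_root_eq_smul_add_smul (S := ℤ) (i := θ)
      (k := P.reflectionPerm k k) (j := θ) (l := i) (x := 1) (y := -1) (by
        rw [root_neg, hk, one_smul, neg_one_smul]; abel)
    rw [h1, P.pairingIn_same]
    simp
    ring
  have h2 := hθ.pairingIn_nonneg hnk
  rw [hpair] at h2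
  have hle : P.pairingIn ℤ i θ ≠ 2 := by
    intro h
    have h4 := root_reflectionPerm_eq (P := P) θ i
    rw [h] at h4
    refine hθ.root_add_ne hnk (P.reflectionPerm (P.reflectionPerm θ i) (P.reflectionPerm θ i)) ?_
    rw [root_neg, root_neg, h4, hk]
    module
  have h1 : P.pairingIn ℤ i θ = 1 := by omega
  refine ⟨h1, ?_⟩
  have h5 : P.reflectionPerm θ i = k := P.root.injective (by
    rw [root_reflectionPerm_eq, h1, hk, one_smul])
  rwa [h5]

end Positive

/-! ### Deletion in an abstract group generated by reflections. -/

section Reflections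

variable {G A : Type*} [Group G] {S : Set A} {r : A → G}

lemma exists_list_of_mem_closure (hsq : ∀ a ∈ S, r a * r a = 1) {g : G}
    (hg : g ∈ Subgroup.closure (r '' S)) : ∃ l : List A, (∀ a ∈ l, a ∈ S) ∧ (l.map r).prod = g := by
  induction hg using Subgroup.closure_induction with
  | mem x hx =>
    obtain ⟨a, ha, rfl⟩ := hx
    exact ⟨[a], by simpa using ha, by simp⟩
  | one => exact ⟨[], by simp, by simp⟩
  | mul x y _ _ hx hy =>
    obtain ⟨l, hl, rfl⟩ := hx
    obtain ⟨l', hl', rfl⟩ := hy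
    exact ⟨l ++ l', fun a ha => (List.mem_append.mp ha).elim (hl a) (hl' a), by simp⟩
  | inv x _ hx =>
    obtain ⟨l, hl, rfl⟩ := hx
    refine ⟨l.reverse, fun a ha => hl a (List.mem_reverse.mp ha), ?_⟩
    rw [List.prod_inv_reverse, List.map_map, List.map_reverse]
    congr 2
    refine List.map_congr_left fun a ha => ?_
    exact eq_inv_of_mul_eq_one_left (hsq a (hl a ha))

variable [MulAction G A] {Pos : A → Prop}

/-- Apply the letters from right to left: the sign turns positive at some letter c. As r c keeps
every positive element other than c positive, the element just obtained must be c. -/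
lemma exists_split_of_pos_prod_smul
    (hperm : ∀ a ∈ S, ∀ c, Pos c → c ≠ a → Pos (r a • c)) (hsq : ∀ a ∈ S, r a * r a = 1)
    {l : List A} (hl : ∀ a ∈ l, a ∈ S) {x : A} (hx : ¬ Pos x) (hpos : Pos ((l.map r).prod • x)) :
    ∃ l₁ c l₂, l = l₁ ++ c :: l₂ ∧ r c • (l₂.map r).prod • x = c := by
  induction l with
  | nil => simp [hx] at hpos
  | cons c l ih =>
    by_cases h : Pos ((l.map r).prod • x)
    · obtain ⟨l₁, d, l₂, rfl, hd⟩ := ih (fun a ha => hl a (List.mem_cons_of_mem _ ha)) h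
      exact ⟨c :: l₁, d, l₂, rfl, hd⟩
    · refine ⟨[], c, l, rfl, ?_⟩
      have hc : c ∈ S := hl c List.mem_cons_self
      rw [List.map_cons, List.prod_cons, mul_smul] at hpos
      by_contra hne
      have := hperm c hc _ hpos hne
      rw [smul_smul, hsq c hc, one_smul] at this
      exact h this

/-- In a group generated by reflections, each of which permutes the positive roots other than its
own, only the identity preserves positivity. -/
lemma eq_one_of_forall_pos_smul
    (hneg : ∀ a ∈ S, ¬ Pos (r a • a))
    (hperm : ∀ a ∈ S, ∀ c, Pos c → c ≠ a → Pos (r a • c)) (hsq : ∀ a ∈ S, r a * r a = 1)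
    (hconj : ∀ g ∈ Subgroup.closure (r '' S), ∀ a ∈ S, r (g • a) = g * r a * g⁻¹)
    {g : G} (hg : g ∈ Subgroup.closure (r '' S)) (hpos : ∀ a ∈ S, Pos (g • a)) : g = 1 := by
  have hmem : ∀ l : List A, (∀ a ∈ l, a ∈ S) → (l.map r).prod ∈ Subgroup.closure (r '' S) := by
    intro l hl
    refine Subgroup.list_prod_mem _ fun x hx => ?_
    obtain ⟨a, ha, rfl⟩ := List.mem_map.mp hx
    exact Subgroup.subset_closure ⟨a, hl a ha, rfl⟩
  obtain ⟨l, hl, rfl⟩ := exists_list_of_mem_closure hsq hg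
  clear hg
  generalize hn : l.length = n
  induction n using Nat.strong_induction_on generalizing l with
  | _ n ih =>
    rcases List.eq_nil_or_concat l with rfl | ⟨l', a, rfl⟩
    · simp
    rw [List.concat_eq_append] at *
    have ha : a ∈ S := hl a (by simp)
    have hl' : ∀ c ∈ l', c ∈ S := fun c hc => hl c (by simp [hc])
    have h1 := hpos a ha
    rw [List.map_append, List.prod_append, mul_smul, List.map_singleton,
      List.prod_singleton] at h1
    obtain ⟨l₁, c, l₂, rfl, hc⟩ :=
      exists_split_of_pos_prod_smul hperm hsq hl' (hneg a ha) h1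
    have hcS : c ∈ S := hl' c (by simp)
    have hl₁ : ∀ c ∈ l₁, c ∈ S := fun d hd => hl' d (by simp [hd])
    have hl₂ : ∀ c ∈ l₂, c ∈ S := fun d hd => hl' d (by simp [hd])
    -- This element sends a to c, so it conjugates r a into r c. Hence l₂ followed on the right by a
    -- equals c followed by l₂, and both letters can be deleted from the word.
    have hK : r c * (l₂.map r).prod * r a ∈ Subgroup.closure (r '' S) :=
      mul_mem (mul_mem (Subgroup.subset_closure ⟨c, hcS, rfl⟩) (hmem _ hl₂))
        (Subgroup.subset_closure ⟨a, ha, rfl⟩)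
    have h2 := hconj _ hK a ha
    rw [mul_smul, mul_smul, hc, eq_mul_inv_iff_mul_eq, mul_assoc _ (r a) (r a), hsq a ha, mul_one,
      ← mul_assoc, ← mul_assoc, hsq c hcS, one_mul] at h2
    have h3 : ((l₁ ++ c :: l₂ ++ [a]).map r).prod = ((l₁ ++ l₂).map r).prod := by
      simp only [List.map_append, List.map_cons, List.map_nil, List.prod_append, List.prod_cons,
        List.prod_nil, mul_one]
      rw [← h2, mul_assoc, mul_assoc, hsq a ha, mul_one]
    rw [h3] at hpos ⊢
    refine ih _ ?_ _ (fun d hd => (List.mem_append.mp hd).elim (hl₁ d) (hl₂ d)) hpos rfl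
    rw [← hn]
    simp only [List.length_append, List.length_cons]
    omega

end Reflections

/-! ### Affine reflections, acting on points and on affine roots. -/

section AffineReflections

variable {ι M N : Type*} [AddCommGroup M] [Module ℝ M] [AddCommGroup N] [Module ℝ N]
  (P : RootPairing ι ℝ M N)

lemma eq_of_forall_root_eq [P.IsRootSystem] {x y : N}
    (h : ∀ i, P.toLinearMap (P.root i) x = P.toLinearMap (P.root i) y) : x = y := by
  apply P.flip.toPerfPair.injective
  ext m
  have hm : m ∈ Submodule.span ℝ (Set.range P.root) := by
    rw [RootPairing.IsRootSystem.span_root_eq_top]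
    trivial
  induction hm using Submodule.span_induction with
  | mem m hm =>
    obtain ⟨i, rfl⟩ := hm
    simpa using h i
  | zero => simp
  | add m m' _ _ h1 h2 => rw [map_add, map_add, h1, h2]
  | smul r m _ h1 => rw [map_smul, map_smul, h1]

lemma reflectionPerm_neg (θ i : ι) :
    P.reflectionPerm (P.reflectionPerm θ θ) i = P.reflectionPerm θ i := by
  apply P.root.injective
  rw [RootPairing.root_reflectionPerm, RootPairing.root_reflectionPerm,
    RootPairing.reflection_reflectionPerm]
  simp

lemma reflectionPerm_neg_right (θ i : ι) :
    P.reflectionPerm θ (P.reflectionPerm i i) =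
      P.reflectionPerm (P.reflectionPerm θ i) (P.reflectionPerm θ i) := by
  apply P.root.injective
  rw [RootPairing.root_reflectionPerm, root_neg, root_neg, map_neg, RootPairing.root_reflectionPerm]

/-- The reflection in the zero hyperplane of the affine root `a`. -/
def affineReflection (a : ι × ℤ) : N ≃ᵃ[ℝ] N :=
  (P.coreflection a.1).toAffineEquiv.trans
    (AffineEquiv.constVAdd ℝ N (-((a.2 : ℝ) • P.coroot a.1)))

variable {P} in
lemma affineReflection_apply (a : ι × ℤ) (x : N) :
    affineReflection P a x = x - affineRootFun P a x • P.coroot a.1 := by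
  simp only [affineReflection, AffineEquiv.trans_apply, LinearEquiv.coe_toAffineEquiv,
    AffineEquiv.constVAdd_apply, vadd_eq_add, RootPairing.coreflection_apply, affineRootFun,
    RootPairing.root']
  module

variable [P.IsCrystallographic]

lemma intCast_pairingIn (i j : ι) :
    (P.pairingIn ℤ i j : ℝ) = P.toLinearMap (P.root i) (P.coroot j) :=
  P.algebraMap_pairingIn ℤ i j

/-- The action of the reflection in the affine root `a` on affine roots. -/
def affineReflectionPerm (a : ι × ℤ) : Equiv.Perm (ι × ℤ) :=
  Function.Involutive.toPerm
    (fun c => (P.reflectionPerm a.1 c.1, c.2 - P.pairingIn ℤ c.1 a.1 * a.2)) (by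
      intro c
      refine Prod.ext (by simp) ?_
      simp only [← P.pairingIn_reflectionPerm ℤ a.1 c.1 a.1,
        RootPairing.pairingIn_reflectionPerm_self_right]
      ring)

lemma affineReflectionPerm_apply (a c : ι × ℤ) :
    affineReflectionPerm P a c =
      (P.reflectionPerm a.1 c.1, c.2 - P.pairingIn ℤ c.1 a.1 * a.2) := rfl

lemma affineReflectionPerm_mul_self (a : ι × ℤ) :
    affineReflectionPerm P a * affineReflectionPerm P a = 1 := by
  ext1 c
  exact (affineReflectionPerm P a).symm_apply_apply c

lemma affineReflectionPerm_inv (a : ι × ℤ) :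
    (affineReflectionPerm P a)⁻¹ = affineReflectionPerm P a :=
  inv_eq_of_mul_eq_one_left (affineReflectionPerm_mul_self P a)

lemma affineRootFun_reflection (a c : ι × ℤ) (x : N) :
    affineRootFun P (affineReflectionPerm P a c) (affineReflection P a x) =
      affineRootFun P c x := by
  rw [affineReflection_apply]
  simp only [affineRootFun, affineReflectionPerm_apply, root_reflectionPerm_eq, map_sub,
    LinearMap.sub_apply, map_smul, map_zsmul, LinearMap.smul_apply, Int.cast_sub, Int.cast_mul,
    smul_eq_mul, zsmul_eq_mul, intCast_pairingIn, RootPairing.root_coroot_two]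
  ring

lemma affineRootFun_reflection' (a c : ι × ℤ) (x : N) :
    affineRootFun P c (affineReflection P a x) =
      affineRootFun P (affineReflectionPerm P a c) x := by
  conv_lhs => rw [← (affineReflectionPerm P a).symm_apply_apply c]
  exact affineRootFun_reflection P a (affineReflectionPerm P a c) x

/-- This is an identity of permutations of affine roots, so the level needs checking as well as the
finite root. It supplies the conjugation hypothesis of `eq_one_of_forall_pos_smul`. -/
lemma affineReflectionPerm_conj (a c : ι × ℤ) :
    affineReflectionPerm P (affineReflectionPerm P a c) =
      affineReflectionPerm P a * affineReflectionPerm P c * affineReflectionPerm P a := by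
  ext1 d
  have hroot : P.root (P.reflectionPerm (P.reflectionPerm a.1 c.1) d.1) =
      P.root (P.reflectionPerm a.1 (P.reflectionPerm c.1 (P.reflectionPerm a.1 d.1))) := by
    simp only [RootPairing.root_reflectionPerm, RootPairing.reflection_reflectionPerm]
    rfl
  simp only [affineReflectionPerm_apply, Equiv.Perm.mul_apply]
  refine Prod.ext (P.root.injective hroot) ?_
  simp only [P.pairingIn_reflectionPerm ℤ a.1 d.1 c.1]
  have h1 : ∀ i j, P.pairingIn ℤ (P.reflectionPerm j i) a.1 =
      P.pairingIn ℤ i a.1 - P.pairingIn ℤ i j * P.pairingIn ℤ j a.1 := by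
    intro i j
    have := P.pairingIn_eq_add_of_root_eq_smul_add_smul (S := ℤ) (i := i)
      (k := P.reflectionPerm j i) (j := a.1) (l := j) (x := 1) (y := -P.pairingIn ℤ i j) (by
        rw [root_reflectionPerm_eq, one_smul, neg_smul, sub_eq_add_neg])
    rw [this]
    simp only [smul_eq_mul]
    ring
  simp only [h1, RootPairing.pairingIn_same]
  ring

end AffineReflections

/-! ### Simple affine roots, the alcove and the group of affine reflections. -/

section SimpleAffineRoots

variable {ι M N : Type*} [AddCommGroup M] [Module ℝ M] [AddCommGroup N] [Module ℝ N]
  {P : RootPairing ι ℝ M N} (b : P.Base)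

/-- The simple affine roots: the simple roots and `-θ + δ` for the highest root `θ`. -/
def simpleAffineRoots : Set (ι × ℤ) :=
  {a | (a.1 ∈ b.support ∧ a.2 = 0) ∨
    ∃ θ, IsHighestRoot b θ ∧ a.1 = P.reflectionPerm θ θ ∧ a.2 = 1}

variable {b}

lemma mem_closedAlcove_one_iff {x : N} :
    x ∈ closedAlcove b 1 ↔ ∀ a ∈ simpleAffineRoots b, 0 ≤ affineRootFun P a x := by
  constructor
  · rintro ⟨h1, h2⟩ ⟨i, k⟩ (⟨hi, hk⟩ | ⟨θ, hθ, hi, hk⟩)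
    · simp only at hi hk
      subst hk
      simpa [affineRootFun] using h1 i hi
    · simp only at hi hk
      subst hk hi
      have := h2 θ hθ
      simp only [affineRootFun, root_neg, map_neg, LinearMap.neg_apply]
      linarith
  · refine fun h => ⟨fun i hi => ?_, fun θ hθ => ?_⟩
    · simpa [affineRootFun] using h (i, 0) (Or.inl ⟨hi, rfl⟩)
    · have := h (_, 1) (Or.inr ⟨θ, hθ, rfl, rfl⟩)
      simp only [affineRootFun, root_neg, map_neg, LinearMap.neg_apply] at this
      push_cast at this ⊢
      linarith

variable [P.IsRootSystem]

lemma isAffinePos_of_mem_simpleAffineRoots {a : ι × ℤ} (ha : a ∈ simpleAffineRoots b) :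
    IsAffinePos b a := by
  rcases ha with ⟨hi, hk⟩ | ⟨θ, hθ, hi, hk⟩
  · exact Or.inl ⟨RootPairing.Base.isPos_of_mem_support hi, hk.ge⟩
  · refine Or.inr ⟨?_, hk.ge⟩
    rw [hi, isPos_neg_iff, not_not]
    exact hθ.isPos

variable [Finite ι]

/-- A form on `M ⊕ ℝδ` that is nonnegative at the simple affine roots is nonnegative at the
positive ones. -/
lemma nonneg_of_simpleAffineRoots (f : M →ₗ[ℝ] ℝ) (t : ℝ)
    (h : ∀ a ∈ simpleAffineRoots b, 0 ≤ f (P.root a.1) + a.2 * t) {a : ι × ℤ}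
    (ha : IsAffinePos b a) : 0 ≤ f (P.root a.1) + a.2 * t := by
  have hs : ∀ i ∈ b.support, 0 ≤ f (P.root i) := by
    intro i hi
    simpa using h (i, 0) (Or.inl ⟨hi, rfl⟩)
  -- Some highest root θ lies above i, and the hypothesis at -θ + δ says f(θ) ≤ t.
  have hle : ∀ i, f (P.root i) ≤ t := by
    intro i
    obtain ⟨θ, hθ, hi⟩ := exists_isHighestRoot_ge (b := b) i
    have h1 := map_nonneg_of_mem_closure hs hi
    have h2 := h (_, 1) (Or.inr ⟨θ, hθ, rfl, rfl⟩)
    simp only [root_neg, map_neg, map_sub] at h1 h2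
    push_cast at h2
    linarith
  have hpos : ∀ i, b.IsPos i → 0 ≤ f (P.root i) := fun i hi =>
    map_nonneg_of_mem_closure hs ((isPos_iff_mem_closure b i).mp hi)
  obtain ⟨i, k⟩ := a
  rcases ha with ⟨hi, hk⟩ | ⟨hi, hk⟩
  · have h1 := hpos i hi
    have h2 := hle i
    have h3 : (0 : ℝ) ≤ k := by exact_mod_cast hk
    have := mul_nonneg h3 (h1.trans h2)
    dsimp only
    linarith
  · have h1 := hpos _ ((isPos_neg_iff b i).mpr hi)
    have h2 := hle (P.reflectionPerm i i)
    rw [root_neg, map_neg] at h1 h2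
    have h3 : (1 : ℝ) ≤ k := by exact_mod_cast hk
    have := mul_nonneg (sub_nonneg.mpr h3) (h1.trans h2)
    dsimp only
    linarith

lemma nonneg_of_mem_closedAlcove_one {x : N} (hx : x ∈ closedAlcove b 1) {a : ι × ℤ}
    (ha : IsAffinePos b a) : 0 ≤ affineRootFun P a x := by
  have := nonneg_of_simpleAffineRoots (P.toLinearMap.flip x) 1 (fun c hc => by
    simpa [affineRootFun] using mem_closedAlcove_one_iff.mp hx c hc) ha
  simpa [affineRootFun] using this

/-- The open alcove. -/
def openAlcove (b : P.Base) : Set N :=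
  {y | ∀ i, b.IsPos i → 0 < P.toLinearMap (P.root i) y ∧ P.toLinearMap (P.root i) y < 1}

omit [Finite ι] in
lemma openAlcove_subset {y : N} (hy : y ∈ openAlcove b) : y ∈ closedAlcove b 1 :=
  ⟨fun i hi => (hy i (RootPairing.Base.isPos_of_mem_support hi)).1.le, fun θ hθ => by
    simpa using (hy θ hθ.isPos).2.le⟩

omit [P.IsRootSystem] in
lemma exists_int_gt_height (b : P.Base) : ∃ n : ℤ, 0 < n ∧ ∀ i, b.height i < n := by
  obtain ⟨B, hB⟩ := (Set.finite_range b.height).bddAbove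
  refine ⟨max 1 (B + 1), by simp, fun i => ?_⟩
  have := hB ⟨i, rfl⟩
  omega

/-- Scale the point whose root values are the heights by the inverse of an integer exceeding every
height. -/
lemma openAlcove_nonempty (b : P.Base) : (openAlcove b).Nonempty := by
  obtain ⟨c, hc⟩ := exists_height_eq b
  obtain ⟨n, hn, hlt⟩ := exists_int_gt_height b
  have hn' : (0 : ℝ) < n := by exact_mod_cast hn
  refine ⟨(n : ℝ)⁻¹ • c, fun i hi => ?_⟩
  rw [map_smul, hc, smul_eq_mul]
  have h1 : (0 : ℝ) < b.height i := by exact_mod_cast hi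
  have h2 : (b.height i : ℝ) < n := by exact_mod_cast hlt i
  refine ⟨by positivity, ?_⟩
  rw [inv_mul_lt_iff₀ hn', mul_one]
  exact h2

variable {y : N}

omit [Finite ι] [P.IsRootSystem] in
lemma affineRootFun_pos (hy : y ∈ openAlcove b) {a : ι × ℤ} (ha : IsAffinePos b a) :
    0 < affineRootFun P a y := by
  obtain ⟨i, k⟩ := a
  simp only [affineRootFun]
  rcases ha with ⟨hi, hk⟩ | ⟨hi, hk⟩
  · have h3 : (0 : ℝ) ≤ k := by exact_mod_cast hk
    linarith [(hy i hi).1]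
  · have h1 := (hy _ ((isPos_neg_iff b i).mpr hi)).2
    rw [root_neg, map_neg, LinearMap.neg_apply] at h1
    have h3 : (1 : ℝ) ≤ k := by exact_mod_cast hk
    linarith

omit [Finite ι] [P.IsRootSystem] in
lemma affineRootFun_neg (hy : y ∈ openAlcove b) {a : ι × ℤ} (ha : ¬ IsAffinePos b a) :
    affineRootFun P a y < 0 := by
  obtain ⟨i, k⟩ := a
  simp only [IsAffinePos, not_or, not_and, not_le] at ha
  simp only [affineRootFun]
  by_cases hi : b.IsPos i
  · have h3 : (k : ℝ) ≤ -1 := by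
      have : k ≤ -1 := by linarith [ha.1 hi, Int.lt_iff_add_one_le.mp (ha.1 hi)]
      exact_mod_cast this
    linarith [(hy i hi).2]
  · have h1 := (hy _ ((isPos_neg_iff b i).mpr hi)).1
    rw [root_neg, map_neg, LinearMap.neg_apply] at h1
    have h3 : (k : ℝ) ≤ 0 := by
      have := Int.lt_iff_add_one_le.mp (ha.2 hi)
      have : k ≤ 0 := by omega
      exact_mod_cast this
    linarith

omit [Finite ι] [P.IsRootSystem] in
lemma isAffinePos_iff (hy : y ∈ openAlcove b) {a : ι × ℤ} :
    IsAffinePos b a ↔ 0 < affineRootFun P a y :=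
  ⟨affineRootFun_pos hy, fun h => by
    by_contra ha
    exact absurd (affineRootFun_neg hy ha) (not_lt.mpr h.le)⟩

variable [P.IsCrystallographic]

omit [Finite ι] [P.IsRootSystem] in
lemma not_isAffinePos_reflection_self {a : ι × ℤ} (ha : IsAffinePos b a) :
    ¬ IsAffinePos b (affineReflectionPerm P a a) := by
  rw [affineReflectionPerm_apply, RootPairing.pairingIn_same]
  simp only [IsAffinePos, isPos_neg_iff] at ha ⊢
  rcases ha with ⟨hi, hk⟩ | ⟨hi, hk⟩ <;> simp only [hi] <;> simp <;> omega

/-- A simple root leaves the level unchanged, so only level 0 matters, where the finite statement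
applies. For -θ + δ, `IsHighestRoot.pairingIn_eq` leaves few cases: the level moves by at most one,
and then the sign of the finite root changes to compensate, except at ±θ, where it moves by two. -/
lemma isAffinePos_reflection [P.IsReduced] {a c : ι × ℤ} (ha : a ∈ simpleAffineRoots b)
    (hc : IsAffinePos b c) (hne : c ≠ a) : IsAffinePos b (affineReflectionPerm P a c) := by
  obtain ⟨j, l⟩ := c
  obtain ⟨i, k⟩ := a
  rw [affineReflectionPerm_apply]
  rcases ha with ⟨hi, hk⟩ | ⟨θ, hθ, hi, hk⟩ <;> simp only at hi hk <;> subst hk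
  · simp only [mul_zero, sub_zero]
    simp only [IsAffinePos] at hc ⊢
    by_cases hl : 1 ≤ l
    · by_cases hp : b.IsPos (P.reflectionPerm i j)
      · exact Or.inl ⟨hp, by omega⟩
      · exact Or.inr ⟨hp, hl⟩
    · have hj : b.IsPos j := by
        by_contra hj
        exact hl (hc.resolve_left fun h => hj h.1).2
      have hl0 : l = 0 := by
        rcases hc with h | h
        · omega
        · exact absurd hj h.1
      subst hl0
      refine Or.inl ⟨hj.reflectionPerm hi fun h => hne (by rw [h]), le_rfl⟩
  · subst hi
    simp only [reflectionPerm_neg, RootPairing.pairingIn_reflectionPerm_self_right]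
    simp only [IsAffinePos] at hc ⊢
    rcases hc with ⟨hj, hl⟩ | ⟨hj, hl⟩
    · by_cases hjθ : j = θ
      · subst hjθ
        refine Or.inr ⟨by rw [isPos_neg_iff, not_not]; exact hj, ?_⟩
        rw [RootPairing.pairingIn_same]
        omega
      rcases hθ.pairingIn_eq hj hjθ with h | ⟨h, h'⟩
      · have : P.reflectionPerm θ j = j := P.root.injective (by
          rw [root_reflectionPerm_eq, h, zero_smul, sub_zero])
        rw [this, h]
        exact Or.inl ⟨hj, by omega⟩
      · exact Or.inr ⟨h', by omega⟩
    · obtain ⟨d, rfl⟩ : ∃ d, j = P.reflectionPerm d d :=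
        ⟨P.reflectionPerm j j, (P.root.injective (by rw [root_neg, root_neg, neg_neg]))⟩
      rw [isPos_neg_iff, not_not] at hj
      rw [reflectionPerm_neg_right, RootPairing.pairingIn_reflectionPerm_self_left, isPos_neg_iff]
      by_cases hjθ : d = θ
      · subst hjθ
        -- Here -θ + lδ goes to θ + (l - 2)δ, which is positive unless l = 1, the excluded simple
        -- root itself.
        have hl1 : l ≠ 1 := fun h => hne (by rw [h])
        refine Or.inl ⟨by rw [isPos_neg_iff, not_not]; exact hj, ?_⟩
        rw [RootPairing.pairingIn_same]
        omega
      rcases hθ.pairingIn_eq hj hjθ with h | ⟨h, h'⟩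
      · have : P.reflectionPerm θ d = d := P.root.injective (by
          rw [root_reflectionPerm_eq, h, zero_smul, sub_zero])
        rw [this, h]
        exact Or.inr ⟨not_not.mpr hj, by omega⟩
      · exact Or.inl ⟨h', by omega⟩

/-- The group generated by the simple affine reflections. -/
def affineReflectionGroup (b : P.Base) : Subgroup (Equiv.Perm (ι × ℤ)) :=
  Subgroup.closure (affineReflectionPerm P '' simpleAffineRoots b)

/-- Otherwise minus the pairing with the coroot of a, extended by 0 to δ, would be nonnegative at
the simple affine roots and hence at a, where its value is -2. -/
lemma exists_simple_pairingIn_pos {a : ι × ℤ} (ha : IsAffinePos b a) :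
    ∃ s ∈ simpleAffineRoots b, 0 < P.pairingIn ℤ a.1 s.1 := by
  by_contra! h
  have h1 := nonneg_of_simpleAffineRoots (-P.toLinearMap.flip (P.coroot a.1)) 0 (fun s hs => by
    have h2 := h s hs
    rw [RootPairing.pairingIn_le_zero_iff] at h2
    have h3 : (P.pairingIn ℤ s.1 a.1 : ℝ) ≤ 0 := by exact_mod_cast h2
    rw [intCast_pairingIn] at h3
    simpa using h3) ha
  simp only [LinearMap.neg_apply, LinearMap.flip_apply, RootPairing.root_coroot_two] at h1
  norm_num at h1

/-- Induct on the affine height ht(α) + kn. With n larger than all heights it is positive on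
positive affine roots, and reflecting in a simple s that pairs positively with a lowers it. The
reflection in a is conjugate by that in s to a reflection already treated. -/
lemma affineReflectionPerm_mem_of_isAffinePos [P.IsReduced] {a : ι × ℤ} (ha : IsAffinePos b a) :
    affineReflectionPerm P a ∈ affineReflectionGroup b := by
  obtain ⟨n, hn, hlt⟩ := exists_int_gt_height b
  have hpos : ∀ c, IsAffinePos b c → 0 < b.height c.1 + c.2 * n := by
    rintro ⟨i, k⟩ (⟨hi, hk⟩ | ⟨hi, hk⟩)
    · have : 0 < b.height i := hi
      have := mul_nonneg hk hn.le
      dsimp only at *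
      omega
    · have h1 := hlt (P.reflectionPerm i i)
      have h2 := b.height_reflectionPerm_self i
      rw [RootPairing.indexNeg_neg] at h2
      rw [h2] at h1
      have := mul_nonneg (sub_nonneg.mpr hk) hn.le
      dsimp only at *
      linarith
  generalize hN : (b.height a.1 + a.2 * n).toNat = m
  induction m using Nat.strong_induction_on generalizing a with
  | _ m ih =>
    obtain ⟨s, hs, hp⟩ := exists_simple_pairingIn_pos ha
    have hsK : affineReflectionPerm P s ∈ affineReflectionGroup b :=
      Subgroup.subset_closure ⟨s, hs, rfl⟩
    by_cases has : a = s
    · rwa [has]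
    have h1 := isAffinePos_reflection hs ha has
    have hht : b.height (affineReflectionPerm P s a).1 + (affineReflectionPerm P s a).2 * n =
        b.height a.1 + a.2 * n - P.pairingIn ℤ a.1 s.1 * (b.height s.1 + s.2 * n) := by
      rw [affineReflectionPerm_apply]
      have h2 := b.height_add_zsmul (i := a.1) (j := s.1) (k := P.reflectionPerm s.1 a.1)
        (z := -P.pairingIn ℤ a.1 s.1) (by rw [root_reflectionPerm_eq, neg_smul, sub_eq_add_neg])
      rw [h2, smul_eq_mul]
      ring
    have h3 := mul_pos hp (hpos s (isAffinePos_of_mem_simpleAffineRoots hs))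
    have h4 := hpos a ha
    have h5 := hpos _ h1
    have h6 := ih _ (by omega) h1 rfl
    rw [affineReflectionPerm_conj] at h6
    have h7 := mul_mem (mul_mem hsK h6) hsK
    simpa only [mul_assoc, affineReflectionPerm_mul_self, mul_one,
      ← mul_assoc (affineReflectionPerm P s) (affineReflectionPerm P s), one_mul] using h7

/-- The affine roots a and -a have the same reflection. -/
lemma affineReflectionPerm_mem [P.IsReduced] (b : P.Base) (a : ι × ℤ) :
    affineReflectionPerm P a ∈ affineReflectionGroup b := by
  by_cases ha : IsAffinePos b a
  · exact affineReflectionPerm_mem_of_isAffinePos ha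
  · have h1 : IsAffinePos b (affineReflectionPerm P a a) := by
      rw [affineReflectionPerm_apply, RootPairing.pairingIn_same]
      simp only [IsAffinePos, isPos_neg_iff] at ha ⊢
      by_cases hi : b.IsPos a.1 <;> simp only [hi] at ha ⊢ <;> simp at ha ⊢ <;> omega
    have h2 := affineReflectionPerm_mem_of_isAffinePos h1
    rwa [affineReflectionPerm_conj, affineReflectionPerm_mul_self, one_mul] at h2

omit [P.IsRootSystem] [Finite ι] in
lemma affineReflectionPerm_smul {g : Equiv.Perm (ι × ℤ)} (hg : g ∈ affineReflectionGroup b)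
    (a : ι × ℤ) :
    affineReflectionPerm P (g a) = g * affineReflectionPerm P a * g⁻¹ := by
  induction hg using Subgroup.closure_induction generalizing a with
  | mem x hx =>
    obtain ⟨s, -, rfl⟩ := hx
    rw [affineReflectionPerm_conj, affineReflectionPerm_inv]
  | one => simp
  | mul x y _ _ hx hy =>
    rw [Equiv.Perm.mul_apply, hx, hy, mul_inv_rev]
    simp only [mul_assoc]
  | inv x _ hx =>
    have := hx (x⁻¹ a)
    rw [← Equiv.Perm.mul_apply, mul_inv_cancel, Equiv.Perm.one_apply] at this
    rw [this]
    group

/-- An element of the affine Weyl group that preserves positivity is trivial. -/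
lemma eq_one_of_forall_isAffinePos [P.IsReduced] {g : Equiv.Perm (ι × ℤ)}
    (hg : g ∈ affineReflectionGroup b) (hpos : ∀ a, IsAffinePos b a → IsAffinePos b (g a)) :
    g = 1 :=
  eq_one_of_forall_pos_smul (S := simpleAffineRoots b) (r := affineReflectionPerm P)
    (Pos := IsAffinePos b)
    (fun _ ha => not_isAffinePos_reflection_self (isAffinePos_of_mem_simpleAffineRoots ha))
    (fun _ ha _ hc hne => isAffinePos_reflection ha hc hne)
    (fun a _ => affineReflectionPerm_mul_self P a)
    (fun _ hg a _ => affineReflectionPerm_smul hg a) hg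
    (fun _ ha => hpos _ (isAffinePos_of_mem_simpleAffineRoots ha))

end SimpleAffineRoots

/-! ### The affine Weyl group: free action on alcoves, and reaching the fundamental alcove. -/

section AffineWeylGroup

variable {ι M N : Type*} [AddCommGroup M] [Module ℝ M] [AddCommGroup N] [Module ℝ N]
  {P : RootPairing ι ℝ M N}

lemma root_smul (v : P.weylGroup) (i : ι) : P.root (v • i) = v • P.root i :=
  (P.weylGroup_apply_root v i).symm

lemma toLinearMap_coweightAct (v : P.weylGroup) (i : ι) (x : N) :
    P.toLinearMap (P.root (v • i)) (coweightAct v x) = P.toLinearMap (P.root i) x := by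
  rw [root_smul, toLinearMap_smul_coweightAct]

lemma toLinearMap_coweightAct_inv (v : P.weylGroup) (i : ι) (x : N) :
    P.toLinearMap (P.root i) (coweightAct v⁻¹ x) = P.toLinearMap (P.root (v • i)) x := by
  have := toLinearMap_coweightAct v⁻¹ (v • i) x
  rwa [inv_smul_smul] at this

lemma smul_reflectionPerm_self (v : P.weylGroup) (i : ι) :
    v • P.reflectionPerm i i = P.reflectionPerm (v • i) (v • i) := by
  apply P.root.injective
  rw [root_smul, root_neg, root_neg, root_smul, smul_neg]

/-- The action of an automorphism of the root system on affine roots. -/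
def indexPerm (g : P.Aut) : Equiv.Perm (ι × ℤ) :=
  (RootPairing.Equiv.indexHom P g).prodCongr (Equiv.refl ℤ)

lemma affineRootFun_indexPerm (v : P.weylGroup) (c : ι × ℤ) (x : N) :
    affineRootFun P (indexPerm (v : P.Aut) c) (coweightAct v x) = affineRootFun P c x :=
  congrArg (· + (c.2 : ℝ)) (toLinearMap_coweightAct v c.1 x)

lemma eq_one_of_indexPerm_eq_one [P.IsRootSystem] {v : P.weylGroup}
    (h : indexPerm (v : P.Aut) = 1) : v = 1 := by
  have h1 : ∀ i : ι, v • i = i := fun i => congrArg Prod.fst (Equiv.congr_fun h (i, 0))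
  apply Subtype.ext
  apply RootPairing.Equiv.weightHom_injective P
  ext m
  have hm : m ∈ Submodule.span ℝ (Set.range P.root) := by
    rw [RootPairing.IsRootSystem.span_root_eq_top]
    trivial
  rw [OneMemClass.coe_one, map_one, LinearEquiv.coe_one, id]
  induction hm using Submodule.span_induction with
  | mem m hm =>
    obtain ⟨i, rfl⟩ := hm
    exact (root_smul v i).symm.trans (congrArg P.root (h1 i))
  | zero => simp
  | add m m' _ _ h1 h2 => rw [map_add, h1, h2]
  | smul r m _ h1 => rw [map_smul, h1]

lemma isAffinePos_of_nonneg {b : P.Base} {y : N} (hy : y ∈ openAlcove b) {a : ι × ℤ}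
    (h : 0 ≤ affineRootFun P a y) : IsAffinePos b a := by
  by_contra ha
  exact absurd (affineRootFun_neg hy ha) (not_lt.mpr h)

/-- For each finite root α only the levels 0 ≤ k < -(α, x) can occur. The size of this set is the
induction parameter in `exists_mem_affineWeylGroup`. -/
lemma finite_isAffinePos_neg [Finite ι] (b : P.Base) (x : N) :
    {c : ι × ℤ | IsAffinePos b c ∧ affineRootFun P c x < 0}.Finite := by
  refine Set.Finite.subset (Set.finite_iUnion fun i : ι =>
    (Set.finite_Ico (0 : ℤ) ⌈-P.toLinearMap (P.root i) x⌉).image (Prod.mk i)) ?_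
  rintro ⟨i, k⟩ ⟨hc, hx⟩
  refine Set.mem_iUnion.mpr ⟨i, k, ⟨?_, ?_⟩, rfl⟩
  · rcases hc with h | h
    · exact h.2
    · exact zero_le_one.trans h.2
  · rw [Int.lt_ceil]
    simp only [affineRootFun] at hx
    linarith

variable [P.IsCrystallographic] [P.IsRootSystem]

lemma coweightAct_ofIdx_mul (j : ι) (v : P.weylGroup) (x : N) :
    coweightAct (RootPairing.weylGroup.ofIdx P j * v) x = P.coreflection j (coweightAct v x) := by
  refine eq_of_forall_root_eq P fun i => ?_
  have h2 : P.toLinearMap (P.root i) (P.coreflection j (coweightAct v x)) =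
      P.toLinearMap (P.root (P.reflectionPerm j i)) (coweightAct v x) := by
    have := affineRootFun_reflection' P (j, 0) (i, 0) (coweightAct v x)
    simpa [affineRootFun, affineReflection_apply, RootPairing.coreflection_apply,
      affineReflectionPerm_apply] using this
  have h3 : RootPairing.weylGroup.ofIdx P j • P.reflectionPerm j i = i :=
    P.reflectionPerm_self j i
  rw [h2]
  conv_lhs => rw [← h3, ← smul_inv_smul v (P.reflectionPerm j i), ← mul_smul,
    toLinearMap_coweightAct]
  conv_rhs => rw [← smul_inv_smul v (P.reflectionPerm j i), toLinearMap_coweightAct]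

lemma affineReflection_mul_mem (a : ι × ℤ) {w : N ≃ᵃ[ℝ] N} (hw : w ∈ affineWeylGroup P) :
    w.trans (affineReflection P a) ∈ affineWeylGroup P := by
  obtain ⟨τ, hτ, v, hv⟩ := hw
  have hint : ∃ n : ℤ, P.toLinearMap (P.root a.1) τ = n := by
    clear hv
    induction hτ using Submodule.span_induction with
    | mem τ hτ =>
      obtain ⟨i, rfl⟩ := hτ
      exact ⟨_, (intCast_pairingIn P a.1 i).symm⟩
    | zero => exact ⟨0, by simp⟩
    | add τ τ' _ _ h1 h2 =>
      obtain ⟨m, h1⟩ := h1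
      obtain ⟨n, h2⟩ := h2
      exact ⟨m + n, by rw [map_add, h1, h2, Int.cast_add]⟩
    | smul n τ _ h1 =>
      obtain ⟨m, h1⟩ := h1
      exact ⟨n * m, by rw [map_zsmul, h1, zsmul_eq_mul, Int.cast_mul]⟩
  obtain ⟨n, hn⟩ := hint
  have hcoroot : P.coroot a.1 ∈ P.corootSpan ℤ := Submodule.subset_span ⟨a.1, rfl⟩
  -- Reflecting vx + τ in α + kδ gives s_α(vx) + τ - ((α, τ) + k)α^∨. The integrality of n = (α, τ)
  -- keeps the translation in the coroot lattice.
  refine ⟨τ - (n + a.2) • P.coroot a.1, sub_mem hτ (Submodule.smul_mem _ _ hcoroot),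
    RootPairing.weylGroup.ofIdx P a.1 * v, fun x => ?_⟩
  rw [coweightAct_ofIdx_mul, AffineEquiv.trans_apply, hv, affineReflection_apply, RootPairing.coreflection_apply]
  simp only [affineRootFun, map_add, hn, RootPairing.root', ← Int.cast_smul_eq_zsmul ℝ]
  push_cast
  module

variable [Finite ι] [P.IsReduced]

lemma indexPerm_mem (b : P.Base) (v : P.weylGroup) :
    indexPerm (v : P.Aut) ∈ affineReflectionGroup b := by
  obtain ⟨g, hg⟩ := v
  induction hg using RootPairing.weylGroup.induction with
  | mem i =>
    convert affineReflectionPerm_mem b (i, 0)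
    ext1 c
    exact Prod.ext rfl (by simp [indexPerm, affineReflectionPerm_apply])
  | one => exact one_mem _
  | mul x y hx hy h1 h2 => exact mul_mem h1 h2

/-- Translation by α^∨ is the product of the reflections in the parallel hyperplanes α = 0 and α =
1, that is, in α and α - δ. -/
lemma exists_perm_translation (b : P.Base) {τ : N} (hτ : τ ∈ P.corootSpan ℤ) :
    ∃ p ∈ affineReflectionGroup b, ∀ c x,
      affineRootFun P (p c) (x + τ) = affineRootFun P c x := by
  induction hτ using Submodule.span_induction with
  | mem τ hτ =>
    obtain ⟨i, rfl⟩ := hτ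
    refine ⟨affineReflectionPerm P (i, -1) * affineReflectionPerm P (i, 0),
      mul_mem (affineReflectionPerm_mem b _) (affineReflectionPerm_mem b _), fun c x => ?_⟩
    have hx : x + P.coroot i = affineReflection P (i, -1) (affineReflection P (i, 0) x) := by
      simp only [affineReflection_apply, affineRootFun, map_sub, map_smul,
        RootPairing.root_coroot_two, smul_eq_mul]
      push_cast
      module
    rw [hx, Equiv.Perm.mul_apply, affineRootFun_reflection, affineRootFun_reflection]
  | zero => exact ⟨1, one_mem _, fun c x => by simp⟩
  | add τ τ' _ _ h1 h2 =>
    obtain ⟨p, hp, h1⟩ := h1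
    obtain ⟨q, hq, h2⟩ := h2
    refine ⟨q * p, mul_mem hq hp, fun c x => ?_⟩
    rw [Equiv.Perm.mul_apply, ← add_assoc, h2, h1]
  | smul n τ _ h1 =>
    obtain ⟨p, hp, h1⟩ := h1
    have hinv : ∀ c x, affineRootFun P (p⁻¹ c) (x + -τ) = affineRootFun P c x := by
      intro c x
      rw [← h1, neg_add_cancel_right, ← Equiv.Perm.mul_apply, mul_inv_cancel,
        Equiv.Perm.one_apply]
    induction n using Int.induction_on with
    | zero => exact ⟨1, one_mem _, fun c x => by simp⟩
    | succ n ih =>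
      obtain ⟨q, hq, h2⟩ := ih
      refine ⟨p * q, mul_mem hp hq, fun c x => ?_⟩
      rw [Equiv.Perm.mul_apply, add_smul, one_smul, ← add_assoc, h1, h2]
    | pred n ih =>
      obtain ⟨q, hq, h2⟩ := ih
      refine ⟨p⁻¹ * q, mul_mem (inv_mem hp) hq, fun c x => ?_⟩
      rw [Equiv.Perm.mul_apply, sub_smul, one_smul, sub_eq_add_neg, ← add_assoc, hinv, h2]

lemma exists_perm_of_mem_affineWeylGroup (b : P.Base) {w : N ≃ᵃ[ℝ] N}
    (hw : w ∈ affineWeylGroup P) :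
    ∃ p ∈ affineReflectionGroup b, ∀ c x,
      affineRootFun P (p c) (w x) = affineRootFun P c x := by
  obtain ⟨τ, hτ, v, hv⟩ := hw
  obtain ⟨p, hp, h⟩ := exists_perm_translation b hτ
  refine ⟨p * indexPerm (v : P.Aut), mul_mem hp (indexPerm_mem b v), fun c x => ?_⟩
  rw [hv, Equiv.Perm.mul_apply, h, affineRootFun_indexPerm]

/-- The affine Weyl group acts freely on alcoves. -/
lemma eq_of_image_closedAlcove_eq (b : P.Base) {w w' : N ≃ᵃ[ℝ] N} (hw : w ∈ affineWeylGroup P)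
    (hw' : w' ∈ affineWeylGroup P) (h : w '' closedAlcove b 1 = w' '' closedAlcove b 1) :
    w = w' := by
  obtain ⟨y, hy⟩ := openAlcove_nonempty b
  obtain ⟨p, hp, hpw⟩ := exists_perm_of_mem_affineWeylGroup b hw
  obtain ⟨p', hp', hpw'⟩ := exists_perm_of_mem_affineWeylGroup b hw'
  have h1 : p'⁻¹ * p = 1 := by
    -- The transformed root has at y the value of a at a point x of the closed alcove with w x = w'
    -- y. Nonnegativity suffices because y is interior.
    refine eq_one_of_forall_isAffinePos (b := b) (mul_mem (inv_mem hp') hp) fun a ha => ?_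
    obtain ⟨x, hx, hxy⟩ : w' y ∈ w '' closedAlcove b 1 := h ▸ ⟨y, openAlcove_subset hy, rfl⟩
    refine isAffinePos_of_nonneg hy ?_
    rw [← hpw', ← hxy, ← Equiv.Perm.mul_apply, mul_inv_cancel_left, hpw]
    exact nonneg_of_mem_closedAlcove_one hx ha
  have h2 : p = p' := by rwa [inv_mul_eq_one, eq_comm] at h1
  ext x
  refine eq_of_forall_root_eq P fun i => ?_
  have h3 := hpw (p⁻¹ (i, 0)) x
  have h4 := hpw' (p⁻¹ (i, 0)) x
  rw [← h2] at h4
  have h5 := h3.trans h4.symm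
  simpa [affineRootFun] using h5

/-- The affine Weyl group moves every regular point into the open alcove. -/
lemma exists_mem_affineWeylGroup (b : P.Base) (x : N) (hx : ∀ a, affineRootFun P a x ≠ 0) :
    ∃ w ∈ affineWeylGroup P, ∃ y ∈ openAlcove b, w y = x := by
  generalize hn : {c : ι × ℤ | IsAffinePos b c ∧ affineRootFun P c x < 0}.ncard = n
  induction n using Nat.strong_induction_on generalizing x with
  | _ n ih =>
    by_cases h : ∀ a ∈ simpleAffineRoots b, 0 ≤ affineRootFun P a x
    · refine ⟨AffineEquiv.refl ℝ N, ⟨0, zero_mem _, 1, fun x => ?_⟩, x, fun i hi => ?_, rfl⟩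
      · refine eq_of_forall_root_eq P fun i => ?_
        have := toLinearMap_coweightAct (1 : P.weylGroup) i x
        rw [one_smul] at this
        rw [add_zero, this, AffineEquiv.refl_apply]
      · have hx' := fun a ha => (nonneg_of_mem_closedAlcove_one (a := a)
          (mem_closedAlcove_one_iff.mpr h) ha).lt_of_ne (hx a).symm
        have h1 := hx' (i, 0) (Or.inl ⟨hi, le_rfl⟩)
        have h2 := hx' (P.reflectionPerm i i, 1)
          (Or.inr ⟨by rw [isPos_neg_iff, not_not]; exact hi, le_rfl⟩)
        simp only [affineRootFun, root_neg, map_neg, LinearMap.neg_apply] at h1 h2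
        push_cast at h1 h2
        constructor <;> linarith
    · push Not at h
      obtain ⟨a, ha, hax⟩ := h
      have hpos := isAffinePos_of_mem_simpleAffineRoots ha
      -- Reflecting in a simple affine root a that is negative at x injects the positive roots
      -- negative at the reflected point into those negative at x, and misses a itself.
      have hsub : affineReflectionPerm P a ''
          {c | IsAffinePos b c ∧ affineRootFun P c (affineReflection P a x) < 0} ⊆
          {c | IsAffinePos b c ∧ affineRootFun P c x < 0} \ {a} := by
        rintro - ⟨c, ⟨hc, hcx⟩, rfl⟩
        rw [affineRootFun_reflection'] at hcx
        have hself : affineRootFun P (affineReflectionPerm P a a) x = -affineRootFun P a x := by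
          simp only [affineRootFun, affineReflectionPerm_apply, root_neg,
            RootPairing.pairingIn_same, map_neg, LinearMap.neg_apply]
          push_cast
          ring
        have hca : c ≠ a := by
          rintro rfl
          linarith
        refine ⟨⟨isAffinePos_reflection ha hc hca, hcx⟩, fun h => ?_⟩
        have h' := congrArg (affineReflectionPerm P a) (Set.mem_singleton_iff.mp h)
        rw [← Equiv.Perm.mul_apply, affineReflectionPerm_mul_self] at h'
        refine not_isAffinePos_reflection_self hpos ?_
        rw [← h']
        exact hc
      have hlt : {c | IsAffinePos b c ∧
          affineRootFun P c (affineReflection P a x) < 0}.ncard < n := by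
        rw [← Set.ncard_image_of_injective _ (affineReflectionPerm P a).injective, ← hn]
        refine (Set.ncard_le_ncard hsub ((finite_isAffinePos_neg b x).sdiff)).trans_lt ?_
        exact Set.ncard_sdiff_singleton_lt_of_mem ⟨hpos, hax⟩ (finite_isAffinePos_neg b x)
      obtain ⟨w, hw, y, hy, hwy⟩ := ih _ hlt (affineReflection P a x)
        (fun c => by rw [affineRootFun_reflection']; exact hx _) rfl
      refine ⟨w.trans (affineReflection P a), affineReflection_mul_mem a hw, y, hy, ?_⟩
      rw [AffineEquiv.trans_apply, hwy]
      refine eq_of_forall_root_eq P fun i => ?_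
      have h1 := affineRootFun_reflection' P a (i, 0) (affineReflection P a x)
      rw [affineRootFun_reflection] at h1
      simpa [affineRootFun] using h1

end AffineWeylGroup

/-! ### The translated alcove z + C̄_1 and its inversions. -/

section Alcoves

variable {ι M N : Type*} [AddCommGroup M] [Module ℝ M] [AddCommGroup N] [Module ℝ N]
  {P : RootPairing ι ℝ M N} {b : P.Base}

/-- `v⁻¹ X` lies in the open fundamental chamber. -/
def IsDominantFor (b : P.Base) (v : P.weylGroup) (X : N) : Prop :=
  ∀ i, b.IsPos i → 0 < P.toLinearMap (P.root (v • i)) X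

lemma IsDominantFor.isPos_iff {v : P.weylGroup} {X : N} (h : IsDominantFor b v X) (i : ι) :
    b.IsPos i ↔ 0 < P.toLinearMap (P.root (v • i)) X := by
  refine ⟨h i, fun h1 => ?_⟩
  by_contra hi
  have h2 := h _ ((isPos_neg_iff b i).mpr hi)
  rw [smul_reflectionPerm_self, root_neg, map_neg, LinearMap.neg_apply] at h2
  linarith

lemma IsDominantFor.inversions_eq {v : P.weylGroup} {X : N} (h : IsDominantFor b v X) :
    inversions b v = {i | b.IsPos i ∧ ¬ 0 < P.toLinearMap (P.root i) X} := by
  ext i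
  rw [inversions, Set.mem_ofPred_eq, Set.mem_ofPred_eq, h.isPos_iff (v⁻¹ • i), smul_inv_smul]

variable [P.IsCrystallographic] [P.IsRootSystem] [Finite ι] [P.IsReduced]

/-- The Weyl group acts freely on the regular points. -/
lemma IsDominantFor.unique {v v' : P.weylGroup} {X : N} (h : IsDominantFor b v X)
    (h' : IsDominantFor b v' X) : v = v' := by
  have h1 : v'⁻¹ * v = 1 := by
    apply eq_one_of_indexPerm_eq_one
    refine eq_one_of_forall_isAffinePos (indexPerm_mem b (v'⁻¹ * v)) fun a ha => ?_
    have h2 : b.IsPos ((v'⁻¹ * v) • a.1) ↔ b.IsPos a.1 := by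
      rw [h'.isPos_iff, h.isPos_iff, mul_smul, smul_inv_smul]
    have h3 : indexPerm ((v'⁻¹ * v : P.weylGroup) : P.Aut) a = ((v'⁻¹ * v) • a.1, a.2) := rfl
    rw [h3]
    simpa only [IsAffinePos, h2] using ha
  rwa [inv_mul_eq_one, eq_comm] at h1

lemma finite_weylGroup (P : RootPairing ι ℝ M N) [P.IsCrystallographic] [P.IsRootSystem]
    [P.IsReduced] : Finite P.weylGroup := by
  refine Finite.of_injective (fun v : P.weylGroup => RootPairing.Equiv.indexHom P (v : P.Aut))
    fun v v' h => ?_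
  have h1 : v'⁻¹ * v = 1 := by
    apply eq_one_of_indexPerm_eq_one
    have h2 : RootPairing.Equiv.indexHom P ((v'⁻¹ * v : P.weylGroup) : P.Aut) = 1 := by
      simp only at h
      rw [Subgroup.coe_mul, map_mul, h, Subgroup.coe_inv, map_inv, inv_mul_cancel]
    rw [indexPerm, h2]
    rfl
  rwa [inv_mul_eq_one, eq_comm] at h1

/-- The Weyl group moves every regular point into the open fundamental chamber. -/
lemma exists_isDominantFor (b : P.Base) {X : N} (hX : ∀ i, P.toLinearMap (P.root i) X ≠ 0) :
    ∃ v : P.weylGroup, IsDominantFor b v X := by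
  have := finite_weylGroup P
  obtain ⟨c, hc⟩ := exists_height_eq b.flip
  -- Here c pairs to 1 with each simple coroot. If a simple root were negative at v⁻¹X, its
  -- reflection would increase the maximized value.
  obtain ⟨v, hv⟩ := Finite.exists_max fun v : P.weylGroup => P.toLinearMap c (coweightAct v⁻¹ X)
  refine ⟨v, fun i hi => ?_⟩
  have key : ∀ j ∈ b.support, 0 < P.toLinearMap (P.root j) (coweightAct v⁻¹ X) := by
    intro j hj
    by_contra h
    have h0 : P.toLinearMap (P.root j) (coweightAct v⁻¹ X) ≠ 0 := by
      rw [toLinearMap_coweightAct_inv]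
      exact hX _
    have hneg := lt_of_le_of_ne (not_lt.mp h) h0
    have h1 := hv (RootPairing.weylGroup.ofIdx P j * v⁻¹)⁻¹
    rw [inv_inv, coweightAct_ofIdx_mul, RootPairing.coreflection_apply, map_sub, map_smul] at h1
    have h2 : P.toLinearMap c (P.coroot j) = 1 := by
      have h3 := hc j
      rw [RootPairing.Base.height_one_of_mem_support (b := b.flip) hj, Int.cast_one] at h3
      exact h3
    rw [h2, smul_eq_mul, mul_one] at h1
    have h4 : P.root' j (coweightAct v⁻¹ X) =
      P.toLinearMap (P.root j) (coweightAct v⁻¹ X) := rfl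
    rw [h4] at h1
    linarith
  have := pos_of_isPos (f := P.toLinearMap.flip (coweightAct v⁻¹ X)) key hi
  rwa [LinearMap.flip_apply, toLinearMap_coweightAct_inv] at this

omit [P.IsCrystallographic] [P.IsRootSystem] [P.IsReduced] in
lemma two_le_coxeterNumber (b : P.Base) (i : ι) : 2 ≤ coxeterNumber b := by
  have h : ∃ j, b.IsPos j := by
    by_cases hi : b.IsPos i
    · exact ⟨i, hi⟩
    · exact ⟨_, (isPos_neg_iff b i).mpr hi⟩
  obtain ⟨j, hj⟩ := h
  have h1 : b.height j ≤ sSup (Set.range b.height) :=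
    le_csSup (Set.finite_range b.height).bddAbove ⟨j, rfl⟩
  have h2 : 0 < b.height j := hj
  rw [coxeterNumber]
  omega

omit [P.IsCrystallographic] [P.IsReduced] in
lemma bounds_of_mem_closedAlcove {y : N} (hy : y ∈ closedAlcove b 1) {i : ι} (hi : b.IsPos i) :
    0 ≤ P.toLinearMap (P.root i) y ∧ P.toLinearMap (P.root i) y ≤ 1 := by
  have h1 := nonneg_of_mem_closedAlcove_one hy (a := (i, 0)) (Or.inl ⟨hi, le_rfl⟩)
  have h2 := nonneg_of_mem_closedAlcove_one hy (a := (P.reflectionPerm i i, 1))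
    (Or.inr ⟨by rw [isPos_neg_iff, not_not]; exact hi, le_rfl⟩)
  simp only [affineRootFun, root_neg, map_neg, LinearMap.neg_apply] at h1 h2
  push_cast at h1 h2
  constructor <;> linarith

variable {z y : N}

omit [P.IsCrystallographic] [P.IsRootSystem] [Finite ι] [P.IsReduced] in
lemma cases_of_mem_zTildeAb (hz : z ∈ zTildeAb b) {i : ι} (hi : b.IsPos i) :
    P.toLinearMap (P.root i) z = 0 ∨ P.toLinearMap (P.root i) z = -1 ∨
      P.toLinearMap (P.root i) z = 1 ∨ P.toLinearMap (P.root i) z = -2 := by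
  simpa using hz.2 i hi

omit [P.IsCrystallographic] [P.IsRootSystem] [Finite ι] [P.IsReduced] in
lemma exists_isPos_or_eq_neg (b : P.Base) (i : ι) :
    b.IsPos i ∨ ∃ j, b.IsPos j ∧ P.root i = -P.root j := by
  by_cases hi : b.IsPos i
  · exact Or.inl hi
  · exact Or.inr ⟨_, (isPos_neg_iff b i).mpr hi, by rw [root_neg, neg_neg]⟩

omit [P.IsCrystallographic] [P.IsRootSystem] [Finite ι] [P.IsReduced] in
lemma affineRootFun_translate_ne_zero (hz : z ∈ zTildeAb b) (hy : y ∈ openAlcove b)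
    (a : ι × ℤ) : affineRootFun P a (z + y) ≠ 0 := by
  obtain ⟨n, hn⟩ := hz.1 a.1
  rw [affineRootFun, map_add, hn]
  intro h
  rcases exists_isPos_or_eq_neg b a.1 with hi | ⟨j, hj, hij⟩
  · obtain ⟨h1, h2⟩ := hy _ hi
    have h3 : (-1 : ℝ) < (n + a.2 : ℤ) := by push_cast; linarith
    have h4 : ((n + a.2 : ℤ) : ℝ) < 0 := by push_cast; linarith
    have h5 : -1 < n + a.2 := by exact_mod_cast h3
    have h6 : n + a.2 < 0 := by exact_mod_cast h4
    omega
  · obtain ⟨h1, h2⟩ := hy _ hj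
    rw [hij, map_neg, LinearMap.neg_apply] at h
    have h3 : (0 : ℝ) < (n + a.2 : ℤ) := by push_cast; linarith
    have h4 : ((n + a.2 : ℤ) : ℝ) < 1 := by push_cast; linarith
    have h5 : 0 < n + a.2 := by exact_mod_cast h3
    have h6 : n + a.2 < 1 := by exact_mod_cast h4
    omega

omit [P.IsCrystallographic] [P.IsRootSystem] [Finite ι] [P.IsReduced] in
lemma toLinearMap_translate_ne_zero (hz : z ∈ zTildeAb b) (hy : y ∈ openAlcove b)
    (i : ι) : P.toLinearMap (P.root i) (z + y) ≠ 0 := by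
  simpa [affineRootFun] using affineRootFun_translate_ne_zero hz hy (i, 0)

omit [P.IsCrystallographic] [P.IsRootSystem] [Finite ι] [P.IsReduced] in
-- The extreme cases are α > 0 with (α, z) = 1 and -α with (α, z) = -2. Both stay strictly below 2
-- since 0 < (α, y) < 1.
lemma toLinearMap_translate_lt_two (hz : z ∈ zTildeAb b) (hy : y ∈ openAlcove b)
    (i : ι) : P.toLinearMap (P.root i) (z + y) < 2 := by
  rcases exists_isPos_or_eq_neg b i with hi | ⟨j, hj, hij⟩
  · have := hy i hi
    rw [map_add]
    rcases cases_of_mem_zTildeAb hz hi with h | h | h | h <;> rw [h] <;> linarith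
  · have := hy j hj
    rw [hij, map_neg, LinearMap.neg_apply, map_add]
    rcases cases_of_mem_zTildeAb hz hj with h | h | h | h <;> rw [h] <;> linarith

omit [P.IsReduced] [P.IsCrystallographic] in
-- By integrality of z, no root changes sign on z + C̄_1, so dominance is decided at z + y. The
-- upper wall is automatic, as root values there are at most 2 ≤ h.
lemma isFinitePart_iff (hz : z ∈ zTildeAb b) (hy : y ∈ openAlcove b) (v : P.weylGroup) :
    IsFinitePart b z v ↔ IsDominantFor b v (z + y) := by
  constructor
  · intro h i hi
    have key : ∀ j ∈ b.support, 0 < P.toLinearMap (P.root j) (coweightAct v⁻¹ (z + y)) := by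
      intro j hj
      refine ((h y (openAlcove_subset hy)).1 j hj).lt_of_ne ?_
      rw [toLinearMap_coweightAct_inv]
      exact (toLinearMap_translate_ne_zero hz hy _).symm
    have := pos_of_isPos (f := P.toLinearMap.flip (coweightAct v⁻¹ (z + y))) key hi
    rwa [LinearMap.flip_apply, toLinearMap_coweightAct_inv] at this
  · intro h x hx
    refine ⟨fun i hi => ?_, fun θ _ => ?_⟩
    · have h1 := h i (RootPairing.Base.isPos_of_mem_support hi)
      rw [toLinearMap_coweightAct_inv, map_add]
      rw [map_add] at h1
      rcases exists_isPos_or_eq_neg b (v • i) with hj | ⟨j, hj, hij⟩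
      · have h2 := bounds_of_mem_closedAlcove hx hj
        have h3 := hy _ hj
        rcases cases_of_mem_zTildeAb hz hj with h | h | h | h <;> rw [h] at h1 ⊢ <;> linarith
      · have h2 := bounds_of_mem_closedAlcove hx hj
        have h3 := hy _ hj
        rw [hij, map_neg, LinearMap.neg_apply, LinearMap.neg_apply] at h1 ⊢
        rcases cases_of_mem_zTildeAb hz hj with h | h | h | h <;> rw [h] at h1 ⊢ <;> linarith
    · have h0 : (2 : ℝ) ≤ coxeterNumber b := by exact_mod_cast two_le_coxeterNumber b θ
      rw [toLinearMap_coweightAct_inv, map_add]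
      rcases exists_isPos_or_eq_neg b (v • θ) with hj | ⟨j, hj, hij⟩
      · have h2 := bounds_of_mem_closedAlcove hx hj
        rcases cases_of_mem_zTildeAb hz hj with h | h | h | h <;> rw [h] <;> linarith
      · have h2 := bounds_of_mem_closedAlcove hx hj
        rw [hij, map_neg, LinearMap.neg_apply, LinearMap.neg_apply]
        rcases cases_of_mem_zTildeAb hz hj with h | h | h | h <;> rw [h] <;> linarith

omit [P.IsCrystallographic] [P.IsRootSystem] [Finite ι] [P.IsReduced] in
lemma inversions_eq_level (hz : z ∈ zTildeAb b) (hy : y ∈ openAlcove b) {v : P.weylGroup}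
    (hv : IsDominantFor b v (z + y)) : inversions b v = level b z (-2) ∪ level b z (-1) := by
  rw [hv.inversions_eq]
  ext i
  simp only [level, Set.mem_ofPred_eq, Set.mem_union, ← and_or_left]
  refine and_congr_right fun hi => ?_
  have := hy i hi
  rw [map_add]
  push_cast
  rcases cases_of_mem_zTildeAb hz hi with h | h | h | h <;> rw [h] <;> norm_num <;> linarith

/-- The roots on which `v⁻¹ X` takes a value greater than one. -/
def rootsGtOne (v : P.weylGroup) (X : N) : Set ι :=
  {i | 1 < P.toLinearMap (P.root (v • i)) X}

omit [P.IsCrystallographic] [P.IsRootSystem] [Finite ι] [P.IsReduced] in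
lemma rootsGtOne_eq (hz : z ∈ zTildeAb b) (hy : y ∈ openAlcove b) (v : P.weylGroup) :
    rootsGtOne v (z + y) = negRoots P ((fun α => v⁻¹ • α) '' level b z (-2)) ∪
      (fun α => v⁻¹ • α) '' level b z 1 := by
  have hsmul : ∀ i j, P.root i = -P.root (v⁻¹ • j) ↔ P.root (v • i) = -P.root j := by
    intro i j
    rw [root_smul v i, root_smul, ← smul_neg, ← smul_left_cancel_iff v, smul_inv_smul]
  ext i
  simp only [rootsGtOne, negRoots, level, Set.mem_ofPred_eq, Set.mem_union, Set.mem_image]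
  constructor
  · intro h1
    rw [map_add] at h1
    rcases exists_isPos_or_eq_neg b (v • i) with hj | ⟨j, hj, hij⟩
    · refine Or.inr ⟨v • i, ⟨hj, ?_⟩, inv_smul_smul v i⟩
      have := hy _ hj
      rcases cases_of_mem_zTildeAb hz hj with h | h | h | h <;> rw [h] at h1 ⊢ <;> norm_num <;>
        linarith
    · refine Or.inl ⟨_, ⟨j, ⟨hj, ?_⟩, rfl⟩, (hsmul i j).mpr hij⟩
      have := hy _ hj
      rw [hij, map_neg, LinearMap.neg_apply, LinearMap.neg_apply] at h1
      rcases cases_of_mem_zTildeAb hz hj with h | h | h | h <;> rw [h] at h1 ⊢ <;> norm_num <;>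
        linarith
  · rintro (⟨_, ⟨j, ⟨hj, hjz⟩, rfl⟩, hij⟩ | ⟨j, ⟨hj, hjz⟩, rfl⟩)
    · have := hy _ hj
      rw [hsmul] at hij
      rw [hij, map_neg, LinearMap.neg_apply, map_add, hjz]
      push_cast
      linarith
    · have := hy _ hj
      rw [smul_inv_smul, map_add, hjz]
      push_cast
      linarith

omit [P.IsRootSystem] [Finite ι] [P.IsReduced] [P.IsCrystallographic] in
-- Integrality of the roots at z is enough here; z need not be in the coroot lattice.
lemma exists_affineRootFun_translate (hz : z ∈ coweightLattice P) (v : P.weylGroup) (c : ι × ℤ) :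
    ∃ c', ∀ x, affineRootFun P c (coweightAct v⁻¹ (z + x)) = affineRootFun P c' x := by
  obtain ⟨n, hn⟩ := hz (v • c.1)
  refine ⟨(v • c.1, c.2 + n), fun x => ?_⟩
  simp only [affineRootFun]
  rw [toLinearMap_coweightAct_inv, map_add, hn]
  push_cast
  ring

omit [P.IsRootSystem] [Finite ι] [P.IsReduced] [P.IsCrystallographic] in
lemma exists_affineRootFun_eq_translate (hz : z ∈ coweightLattice P) (v : P.weylGroup)
    (c : ι × ℤ) :
    ∃ c', ∀ x, affineRootFun P c x = affineRootFun P c' (coweightAct v⁻¹ (z + x)) := by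
  obtain ⟨n, hn⟩ := hz c.1
  refine ⟨(v⁻¹ • c.1, c.2 - n), fun x => ?_⟩
  simp only [affineRootFun]
  rw [toLinearMap_coweightAct_inv, smul_inv_smul, map_add, hn]
  push_cast
  ring

/-- Both maps carry affine roots to affine roots and their images share an interior point. A root
positive there is nonnegative on each whole image, so the images satisfy the same inequalities. -/
lemma image_translate_eq (hz : z ∈ coweightLattice P) (v : P.weylGroup) {w : N ≃ᵃ[ℝ] N}
    (hw : w ∈ affineWeylGroup P) {y' : N} (hy : y ∈ openAlcove b) (hy' : y' ∈ openAlcove b)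
    (h : w y' = coweightAct v⁻¹ (z + y)) :
    (fun y => coweightAct v⁻¹ (z + y)) '' closedAlcove b 1 = w '' closedAlcove b 1 := by
  obtain ⟨p, -, hp⟩ := exists_perm_of_mem_affineWeylGroup b hw
  apply Set.Subset.antisymm
  · rintro - ⟨x, hx, rfl⟩
    refine ⟨w.symm (coweightAct v⁻¹ (z + x)), ?_, w.apply_symm_apply _⟩
    rw [mem_closedAlcove_one_iff]
    intro a ha
    obtain ⟨c, hc⟩ := exists_affineRootFun_translate hz v (p a)
    rw [← hp, w.apply_symm_apply, hc]
    refine nonneg_of_mem_closedAlcove_one hx ((isAffinePos_iff hy).mpr ?_)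
    rw [← hc, ← h, hp]
    exact affineRootFun_pos hy' (isAffinePos_of_mem_simpleAffineRoots ha)
  · rintro - ⟨t, ht, rfl⟩
    obtain ⟨x, hx⟩ : ∃ x, coweightAct v⁻¹ (z + x) = w t :=
      ⟨(coweightAct v⁻¹).symm (w t) - z, by
        rw [add_sub_cancel, LinearEquiv.apply_symm_apply]⟩
    refine ⟨x, ?_, hx⟩
    rw [mem_closedAlcove_one_iff]
    intro a ha
    obtain ⟨c, hc⟩ := exists_affineRootFun_eq_translate hz v a
    have hpc : ∀ s, affineRootFun P c (w s) = affineRootFun P (p⁻¹ c) s := fun s => by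
      rw [← hp (p⁻¹ c), ← Equiv.Perm.mul_apply, mul_inv_cancel, Equiv.Perm.one_apply]
    rw [hc, hx, hpc]
    refine nonneg_of_mem_closedAlcove_one ht ((isAffinePos_iff hy').mpr ?_)
    rw [← hpc, h, ← hc]
    exact affineRootFun_pos hy (isAffinePos_of_mem_simpleAffineRoots ha)

lemma affineInversions_eq {w : N ≃ᵃ[ℝ] N} (hw : w ∈ affineWeylGroup P) {y' : N}
    (hy' : y' ∈ openAlcove b) :
    affineInversions b w = {a | IsAffinePos b a ∧ affineRootFun P a (w y') < 0} := by
  obtain ⟨p, -, hp⟩ := exists_perm_of_mem_affineWeylGroup b hw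
  ext a
  refine and_congr_right fun _ => ⟨?_, fun h => ⟨p⁻¹ a, ?_, ?_⟩⟩
  · rintro ⟨c, hc, h⟩
    rw [← h]
    exact affineRootFun_neg hy' hc
  · rw [isAffinePos_iff hy', ← hp, ← Equiv.Perm.mul_apply, mul_inv_cancel, Equiv.Perm.one_apply]
    exact not_lt.mpr h.le
  · intro x
    rw [← hp, ← Equiv.Perm.mul_apply, mul_inv_cancel, Equiv.Perm.one_apply]

omit [P.IsCrystallographic] [P.IsRootSystem] [Finite ι] [P.IsReduced] in
-- Since roots are below 2 at the dominant point x, a positive affine root negative at x must be -α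
-- + δ with (α, x) > 1. Conversely, the level-one layer of the affine set recovers Φ.
lemma affineSet_eq_iff {x : N}
    (hx : ∀ i, b.IsPos i → 0 < P.toLinearMap (P.root i) x)
    (hlt : ∀ i, P.toLinearMap (P.root i) x < 2) (Φ : Set ι) :
    affineSet P Φ = {a | IsAffinePos b a ∧ affineRootFun P a x < 0} ↔
      Φ = {i | 1 < P.toLinearMap (P.root i) x} := by
  have hneg : ∀ i, ¬ b.IsPos i → P.toLinearMap (P.root i) x < 0 := by
    intro i hi
    have := hx _ ((isPos_neg_iff b i).mpr hi)
    rw [root_neg, map_neg, LinearMap.neg_apply] at this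
    linarith
  constructor
  · intro h
    ext i
    have h1 : i ∈ Φ ↔ (P.reflectionPerm i i, (1 : ℤ)) ∈ affineSet P Φ := by
      constructor
      · intro hi
        exact ⟨0, ⟨i, hi, root_neg P i⟩, by simp⟩
      · rintro ⟨n, ⟨j, hj, hij⟩, hn⟩
        -- Level 1 corresponds to index 0, since `rootPow` is shifted by one.
        have hn0 : n = 0 := by simp only at hn; omega
        subst hn0
        rw [root_neg, neg_inj] at hij
        rwa [P.root.injective hij]
    rw [h1, h]
    simp only [Set.mem_ofPred_eq, affineRootFun, root_neg, map_neg, LinearMap.neg_apply,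
      IsAffinePos, isPos_neg_iff]
    push_cast
    constructor
    · rintro ⟨-, h2⟩
      linarith
    · intro h2
      refine ⟨Or.inr ⟨fun h3 => ?_, trivial⟩, by linarith⟩
      have := hneg i h3
      linarith
  · rintro rfl
    -- A root that is a sum of two elements of Φ would exceed 2 at x, so Φ² and all later powers are
    -- empty.
    have hpow : ∀ n i, i ∉ rootPow P {i | 1 < P.toLinearMap (P.root i) x} (n + 1) := by
      intro n
      induction n with
      | zero =>
        rintro i ⟨j, hj, l, hl, hi⟩
        have h1 := hlt i
        rw [hi, map_add, LinearMap.add_apply] at h1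
        simp only [rootPow, Set.mem_ofPred_eq] at hj hl
        linarith
      | succ n ih =>
        rintro i ⟨j, hj, -⟩
        exact ih j hj
    ext ⟨i, k⟩
    constructor
    · rintro ⟨n, ⟨j, hj, hij⟩, hk⟩
      obtain rfl : n = 0 := by
        cases n with
        | zero => rfl
        | succ n => exact absurd hj (hpow n j)
      simp only [rootPow, Set.mem_ofPred_eq] at hj hij hk
      subst hk
      simp only [Set.mem_ofPred_eq, affineRootFun, hij, map_neg, LinearMap.neg_apply, IsAffinePos]
      push_cast
      refine ⟨Or.inr ⟨fun h => ?_, by norm_num⟩, by linarith⟩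
      have := hx i h
      rw [hij, map_neg, LinearMap.neg_apply] at this
      linarith
    · rintro ⟨h1, h2⟩
      simp only [affineRootFun] at h2
      rcases h1 with ⟨hi, hk⟩ | ⟨hi, hk⟩
      · have h3 := hx i hi
        have h4 : (0 : ℝ) ≤ k := by exact_mod_cast hk
        linarith
      · have h3 := hlt (P.reflectionPerm i i)
        rw [root_neg, map_neg, LinearMap.neg_apply] at h3
        have h4 : (k : ℝ) < 2 := by linarith
        have h5 : k < 2 := by exact_mod_cast h4
        obtain rfl : k = 1 := by simp only at hk; omega
        refine ⟨0, ⟨P.reflectionPerm i i, ?_, by rw [root_neg, neg_neg]⟩, by simp⟩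
        simp only [rootPow, Set.mem_ofPred_eq, root_neg, map_neg, LinearMap.neg_apply]
        push_cast at h2
        linarith

/-- The combinatorial content: the finite and the affine part of a point of `Z̃_ab`, and the set of
roots of the associated abelian ideal. -/
theorem exists_finitePart_affinePart (hz : z ∈ zTildeAb b) :
    ∃ (v : P.weylGroup) (w : N ≃ᵃ[ℝ] N) (Φ : Set ι),
      (∀ v', IsFinitePart b z v' ↔ v' = v) ∧
      (∀ w', IsAffinePart b z v w' ↔ w' = w) ∧
      inversions b v = level b z (-2) ∪ level b z (-1) ∧
      Φ = negRoots P ((fun α => v⁻¹ • α) '' level b z (-2)) ∪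
        (fun α => v⁻¹ • α) '' level b z 1 ∧
      (∀ Φ', affineSet P Φ' = affineInversions b w ↔ Φ' = Φ) ∧
      (∀ i ∈ Φ, b.IsPos i) ∧
      (∀ i ∈ Φ, ∀ j, b.IsPos j → ∀ k, P.root k = P.root i + P.root j → k ∈ Φ) ∧
      (∀ i ∈ Φ, ∀ j ∈ Φ, ∀ k, P.root k ≠ P.root i + P.root j) := by
  obtain ⟨y, hy⟩ := openAlcove_nonempty b
  obtain ⟨v, hv⟩ := exists_isDominantFor b (toLinearMap_translate_ne_zero hz hy)
  obtain ⟨w, hw, y', hy', hwy⟩ := exists_mem_affineWeylGroup b (coweightAct v⁻¹ (z + y))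
    (fun a => by
      simp only [affineRootFun]
      rw [toLinearMap_coweightAct_inv]
      exact affineRootFun_translate_ne_zero hz hy (v • a.1, a.2))
  have himage := image_translate_eq hz.1 v hw hy hy' hwy
  refine ⟨v, w, rootsGtOne v (z + y), fun v' => ?_, fun w' => ?_,
    inversions_eq_level hz hy hv, rootsGtOne_eq hz hy v, fun Φ' => ?_, fun i hi => ?_,
    fun i hi j hj k hk => ?_, fun i hi j hj k hk => ?_⟩
  · rw [isFinitePart_iff hz hy]
    exact ⟨fun h => h.unique hv, fun h => h ▸ hv⟩
  · refine ⟨fun h => ?_, fun h => h ▸ ⟨hw, himage⟩⟩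
    exact eq_of_image_closedAlcove_eq b h.1 hw (h.2.symm.trans himage)
  · rw [affineInversions_eq hw hy', hwy, affineSet_eq_iff]
    · simp only [toLinearMap_coweightAct_inv]
      rfl
    · intro i hi
      rw [toLinearMap_coweightAct_inv]
      exact hv i hi
    · intro i
      rw [toLinearMap_coweightAct_inv]
      exact toLinearMap_translate_lt_two hz hy _
  · exact (hv.isPos_iff i).mpr (zero_lt_one.trans hi)
  · have h1 := hv j hj
    simp only [rootsGtOne, Set.mem_ofPred_eq] at hi ⊢
    rw [root_smul, hk, smul_add, ← root_smul, ← root_smul, LinearMap.map_add₂]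
    linarith
  · have h1 := toLinearMap_translate_lt_two hz hy (v • k)
    simp only [rootsGtOne, Set.mem_ofPred_eq] at hi hj
    rw [root_smul, hk, smul_add, ← root_smul, ← root_smul, LinearMap.map_add₂] at h1
    linarith

end Alcoves

/-! ### Ideals of the Borel subalgebra and sets of positive roots. -/

section LieAlgebra

open LieAlgebra

variable {L : Type*} [LieRing L] [LieAlgebra ℂ L] [FiniteDimensional ℂ L]
  [LieAlgebra.IsSimple ℂ L] {H : LieSubalgebra ℂ L} [H.IsCartanSubalgebra]

instance : (realRootSystem H).IsCrystallographic where
  exists_value i j := by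
    obtain ⟨n, hn⟩ := (IsKilling.rootSystem H).exists_value (S := ℤ) i j
    refine ⟨n, ?_⟩
    have hval := RootPairing.IsValuedIn.trans (IsKilling.rootSystem H) ℝ ℤ
    have h := (IsKilling.rootSystem H).restrictScalars_pairing ℝ i j
    rw [← hn] at h
    apply FaithfulSMul.algebraMap_injective ℝ ℂ
    rw [h]
    simp

instance : (realRootSystem H).IsReduced where
  eq_or_eq_neg i j h := by
    have h1 : ¬ LinearIndependent ℂ
        ![(IsKilling.rootSystem H).root i, (IsKilling.rootSystem H).root j] := by
      intro h2
      apply h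
      have h3 := h2.restrict_scalars' ℝ
      refine LinearIndependent.of_comp (hRealDual H).subtype ?_
      have h4 : (hRealDual H).subtype ∘
          ![(realRootSystem H).root i, (realRootSystem H).root j] =
          ![(IsKilling.rootSystem H).root i, (IsKilling.rootSystem H).root j] := by
        ext1 k
        fin_cases k <;> rfl
      rw [h4]
      exact h3
    rcases RootPairing.IsReduced.eq_or_eq_neg i j h1 with h2 | h2
    · exact Or.inl (Subtype.ext h2)
    · exact Or.inr (Subtype.ext h2)

variable {b : (realRootSystem H).Base}

omit [LieAlgebra.IsSimple ℂ L] in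
lemma rootSpace_le_rootSpaceSum {Φ : Set H.root} {α : H.root} (hα : α ∈ Φ) :
    (rootSpace H α.1).toSubmodule ≤ rootSpaceSum Φ :=
  le_iSup₂_of_le (f := fun (α : H.root) (_ : α ∈ Φ) => (rootSpace H α.1).toSubmodule) α hα le_rfl

omit [LieAlgebra.IsSimple ℂ L] in
lemma rootSpaceSum_induction {Φ : Set H.root} {p : L → Prop}
    (hmem : ∀ α ∈ Φ, ∀ x ∈ rootSpace H α.1, p x) (hzero : p 0)
    (hadd : ∀ x y, p x → p y → p (x + y)) {x : L} (hx : x ∈ rootSpaceSum Φ) : p x := by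
  refine Submodule.iSup_induction (fun α : H.root => ⨆ _ : α ∈ Φ, (rootSpace H α.1).toSubmodule)
    (motive := p) hx (fun α y hy => ?_) hzero hadd
  by_cases hα : α ∈ Φ
  · exact hmem α hα y (by simpa [hα] using hy)
  · have : y = 0 := by simpa [hα] using hy
    rwa [this]

/-- A nonzero bracket makes α + β a weight, and it is not the zero weight because α and -α are never
both positive. -/
lemma lie_eq_zero_or_mem_rootSpace {α β : H.root} (hα : b.IsPos α) (hβ : b.IsPos β) {x y : L}
    (hx : x ∈ rootSpace H α.1) (hy : y ∈ rootSpace H β.1) :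
    ⁅x, y⁆ = 0 ∨ ∃ γ : H.root, (realRootSystem H).root γ =
      (realRootSystem H).root α + (realRootSystem H).root β ∧ ⁅x, y⁆ ∈ rootSpace H γ.1 := by
  have h := lie_mem_genWeightSpace_of_mem_genWeightSpace hx hy
  by_cases h0 : ⁅x, y⁆ = 0
  · exact Or.inl h0
  right
  have hne : LieModule.genWeightSpace L ((α.1 : H → ℂ) + (β.1 : H → ℂ)) ≠ ⊥ := by
    intro hbot
    rw [hbot] at h
    exact h0 (by simpa using h)
  let γ : LieModule.Weight ℂ H L := ⟨_, hne⟩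
  by_cases hγ : γ.IsZero
  · exfalso
    have hsum : (realRootSystem H).root α = -(realRootSystem H).root β := by
      rw [eq_neg_iff_add_eq_zero]
      ext u
      exact congrFun hγ u
    rw [← root_neg] at hsum
    rw [(realRootSystem H).root.injective hsum, isPos_neg_iff] at hα
    exact hα hβ
  · refine ⟨⟨γ, by simpa using hγ⟩, ?_, h⟩
    ext u
    rfl

lemma mem_borelSubalgebra {x : L} :
    x ∈ borelSubalgebra b ↔ x ∈ H.toSubmodule ⊔ nilradical b := Iff.rfl

lemma rootSpaceSum_le_nilradical {Φ : Set H.root} (hpos : ∀ α ∈ Φ, b.IsPos α) :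
    rootSpaceSum Φ ≤ nilradical b :=
  iSup₂_le fun _ hα => rootSpace_le_rootSpaceSum (hpos _ hα)

lemma lie_mem_rootSpaceSum {Φ : Set H.root} (hpos : ∀ α ∈ Φ, b.IsPos α)
    (hup : ∀ α ∈ Φ, ∀ β, b.IsPos β → ∀ γ, (realRootSystem H).root γ =
      (realRootSystem H).root α + (realRootSystem H).root β → γ ∈ Φ)
    {x y : L} (hx : x ∈ rootSpaceSum Φ) (hy : y ∈ borelSubalgebra b) :
    ⁅x, y⁆ ∈ rootSpaceSum Φ := by
  refine rootSpaceSum_induction (p := fun x => ⁅x, y⁆ ∈ rootSpaceSum Φ) (fun α hα u hu => ?_)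
    (by simp) (fun u v hu hv => ?_) hx
  · obtain ⟨s, hs, t, ht, rfl⟩ := Submodule.mem_sup.mp (mem_borelSubalgebra.mp hy)
    rw [lie_add]
    refine add_mem ?_ ?_
    · have hs' : s ∈ rootSpace H (0 : H → ℂ) := by
        rw [LieAlgebra.rootSpace_zero_eq ℂ L H]
        exact hs
      have h := lie_mem_genWeightSpace_of_mem_genWeightSpace hu hs'
      rw [add_zero] at h
      exact rootSpace_le_rootSpaceSum hα h
    · refine rootSpaceSum_induction (p := fun t => ⁅u, t⁆ ∈ rootSpaceSum Φ) (fun β hβ t ht => ?_)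
        (by simp) (fun s t hs ht => ?_) ht
      · rcases lie_eq_zero_or_mem_rootSpace (hpos α hα) hβ hu ht with h | ⟨γ, hγ, h⟩
        · rw [h]
          exact zero_mem _
        · exact rootSpace_le_rootSpaceSum (hup α hα β hβ γ hγ) h
      · rw [lie_add]
        exact add_mem hs ht
  · rw [add_lie]
    exact add_mem hu hv

lemma lie_eq_zero_of_mem_rootSpaceSum {Φ : Set H.root} (hpos : ∀ α ∈ Φ, b.IsPos α)
    (hab : ∀ α ∈ Φ, ∀ β ∈ Φ, ∀ γ, (realRootSystem H).root γ ≠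
      (realRootSystem H).root α + (realRootSystem H).root β)
    {x y : L} (hx : x ∈ rootSpaceSum Φ) (hy : y ∈ rootSpaceSum Φ) : ⁅x, y⁆ = 0 := by
  refine rootSpaceSum_induction (p := fun x => ⁅x, y⁆ = 0) (fun α hα u hu => ?_)
    (by simp) (fun u v hu hv => by rw [add_lie, hu, hv, add_zero]) hx
  refine rootSpaceSum_induction (p := fun t => ⁅u, t⁆ = 0) (fun β hβ t ht => ?_)
    (by simp) (fun s t hs ht => by rw [lie_add, hs, ht, add_zero]) hy
  rcases lie_eq_zero_or_mem_rootSpace (hpos α hα) (hpos β hβ) hu ht with h | ⟨γ, hγ, -⟩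
  · exact h
  · exact absurd hγ (hab α hα β hβ γ)

omit [LieAlgebra.IsSimple ℂ L] in
lemma disjoint_rootSpaceSum {Φ : Set H.root} {χ : LieModule.Weight ℂ H L}
    (hχ : ∀ α ∈ Φ, α.1 ≠ χ) :
    Disjoint (rootSpaceSum Φ) (rootSpace H χ).toSubmodule := by
  have hind := LieSubmodule.iSupIndep_toSubmodule.mpr
    (LieModule.iSupIndep_genWeightSpace' ℂ H L)
  have h := hind.disjoint_biSup (x := χ) (y := Subtype.val '' Φ) (by
    rintro ⟨α, hα, h⟩
    exact hχ α hα h)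
  rw [iSup_image] at h
  exact h.symm

omit [LieAlgebra.IsSimple ℂ L] in
lemma rootSpace_le_rootSpaceSum_iff {Φ : Set H.root} {α : H.root} :
    (rootSpace H α.1).toSubmodule ≤ rootSpaceSum Φ ↔ α ∈ Φ := by
  refine ⟨fun h => ?_, rootSpace_le_rootSpaceSum⟩
  by_contra hα
  have h1 := disjoint_rootSpaceSum (Φ := Φ) (χ := α.1) (fun β hβ h => hα (by
    rwa [← Subtype.ext h]))
  have h2 := h1.mono_left h
  rw [disjoint_self, LieSubmodule.toSubmodule_eq_bot] at h2
  exact α.1.genWeightSpace_ne_bot' h2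

lemma toSubspace_injective : Function.Injective (toSubspace (b := b)) := by
  intro I J h
  exact LieSubmodule.toSubmodule_injective
    (Submodule.map_injective_of_injective Subtype.val_injective h)

lemma lie_mem_toSubspace (I : LieIdeal ℂ (borelSubalgebra b)) {x y : L}
    (hx : x ∈ borelSubalgebra b) (hy : y ∈ toSubspace I) : ⁅x, y⁆ ∈ toSubspace I := by
  obtain ⟨u, hu, rfl⟩ := hy
  exact ⟨⁅(⟨x, hx⟩ : borelSubalgebra b), u⁆, I.lie_mem hu, rfl⟩

/-- An ideal of the Borel subalgebra inside the nilradical is the sum of its root spaces. -/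
lemma toSubspace_eq_rootSpaceSum {I : LieIdeal ℂ (borelSubalgebra b)}
    (hI : toSubspace I ≤ nilradical b) : toSubspace I = rootSpaceSum (idealRoots I) := by
  -- Since 𝔥 lies in 𝔟, the ideal is an 𝔥-submodule and hence the sum of its intersections with the
  -- weight spaces.
  let J : LieSubmodule ℂ H L :=
    { toSubspace I with
      lie_mem := fun {x _} hm =>
        lie_mem_toSubspace I (mem_borelSubalgebra.mpr (Submodule.mem_sup_left x.2)) hm }
  have hJ : J.toSubmodule = toSubspace I := rfl
  apply le_antisymm
  · rw [← hJ, LieModule.eq_iSup_inf_genWeightSpace (K := ℂ) (N := J), LieSubmodule.iSup_toSubmodule]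
    refine iSup_le fun χ => ?_
    rw [LieSubmodule.inf_toSubmodule, hJ]
    by_cases hχ : ∃ α : H.root, b.IsPos α ∧ α.1 = χ
    · obtain ⟨α, hα, rfl⟩ := hχ
      -- Root spaces are one-dimensional, so the intersection is everything or zero.
      by_cases hle : (rootSpace H α.1).toSubmodule ≤ toSubspace I
      · exact inf_le_right.trans (rootSpace_le_rootSpaceSum ⟨hα, hle⟩)
      · have hatom := Submodule.isAtom_iff_finrank_eq_one.mpr
          (IsKilling.finrank_rootSpace_eq_one α.1 (LieSubalgebra.isNonZero_coe_root α))
        rw [((hatom.not_le_iff_disjoint).mp hle).symm.eq_bot]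
        exact bot_le
    · push Not at hχ
      -- The remaining weights, zero included, do not occur in 𝔫.
      rw [((disjoint_rootSpaceSum hχ).mono_left hI).eq_bot]
      exact bot_le
  · exact iSup₂_le fun α hα => hα.2

/-- The ideal of the Borel subalgebra attached to a set of positive roots that is closed under
adding positive roots. -/
def idealOfRoots (Φ : Set H.root) (hpos : ∀ α ∈ Φ, b.IsPos α)
    (hup : ∀ α ∈ Φ, ∀ β, b.IsPos β → ∀ γ, (realRootSystem H).root γ =
      (realRootSystem H).root α + (realRootSystem H).root β → γ ∈ Φ) :
    LieIdeal ℂ (borelSubalgebra b) where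
  __ := (rootSpaceSum Φ).comap (borelSubalgebra b).toSubmodule.subtype
  lie_mem {x m} hm := by
    have h := lie_mem_rootSpaceSum hpos hup (x := (m : L)) hm x.2
    rw [← lie_skew, neg_mem_iff] at h
    exact h

section IdealOfRoots

variable {Φ : Set H.root} (hpos : ∀ α ∈ Φ, b.IsPos α)
  (hup : ∀ α ∈ Φ, ∀ β, b.IsPos β → ∀ γ, (realRootSystem H).root γ =
    (realRootSystem H).root α + (realRootSystem H).root β → γ ∈ Φ)

lemma toSubspace_idealOfRoots : toSubspace (idealOfRoots Φ hpos hup) = rootSpaceSum Φ := by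
  have h : rootSpaceSum Φ ≤ (borelSubalgebra b).toSubmodule :=
    (rootSpaceSum_le_nilradical hpos).trans le_sup_right
  refine (Submodule.map_comap_eq _ _).trans ?_
  rw [Submodule.range_subtype]
  exact inf_eq_right.mpr h

lemma idealRoots_idealOfRoots : idealRoots (idealOfRoots Φ hpos hup) = Φ := by
  ext α
  simp only [idealRoots, toSubspace_idealOfRoots, rootSpace_le_rootSpaceSum_iff]
  exact ⟨fun h => h.2, fun h => ⟨hpos α h, h⟩⟩

lemma isLieAbelian_idealOfRoots (hab : ∀ α ∈ Φ, ∀ β ∈ Φ, ∀ γ, (realRootSystem H).root γ ≠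
      (realRootSystem H).root α + (realRootSystem H).root β) :
    IsLieAbelian (idealOfRoots Φ hpos hup) where
  trivial x y := Subtype.ext (Subtype.ext
    (lie_eq_zero_of_mem_rootSpaceSum hpos hab (x := ((x : borelSubalgebra b) : L))
      (y := ((y : borelSubalgebra b) : L)) x.2 y.2))

end IdealOfRoots

end LieAlgebra

end AffineIdeals

end

open AffineIdeals
theorem proposition1p7 {L : Type*} [LieRing L] [LieAlgebra ℂ L] [FiniteDimensional ℂ L]
    [LieAlgebra.IsSimple ℂ L] (H : LieSubalgebra ℂ L) [H.IsCartanSubalgebra]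
    (b : (realRootSystem H).Base) (z : hReal H) (hz : z ∈ zTildeAb b) :
    ∃ (v : (realRootSystem H).weylGroup) (w : hReal H ≃ᵃ[ℝ] hReal H)
      (I : LieIdeal ℂ (borelSubalgebra b)),
      (∀ v', IsFinitePart b z v' ↔ v' = v) ∧
      (∀ w', IsAffinePart b z v w' ↔ w' = w) ∧
      (∀ I' : LieIdeal ℂ (borelSubalgebra b), IsIdealOf w I' ↔ I' = I) ∧
      IsLieAbelian I ∧
      inversions b v = level b z (-2) ∪ level b z (-1) ∧
      idealRoots I = negRoots (realRootSystem H) ((fun α => v⁻¹ • α) '' level b z (-2)) ∪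
        (fun α => v⁻¹ • α) '' level b z 1 ∧
      toSubspace I = rootSpaceSum
        (negRoots (realRootSystem H) ((fun α => v⁻¹ • α) '' level b z (-2)) ∪
          (fun α => v⁻¹ • α) '' level b z 1) := by
  obtain ⟨v, w, Φ, hv, hw, hinv, hΦ, haff, hpos, hup, hab⟩ := exists_finitePart_affinePart hz
  refine ⟨v, w, idealOfRoots Φ hpos hup, hv, hw, fun I' => ⟨?_, ?_⟩,
    isLieAbelian_idealOfRoots hpos hup hab, hinv, ?_, ?_⟩
  · rintro ⟨hle, hI⟩
    -- The affine inversions determine the roots of I', and these determine I' because it lies in 𝔫.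
    apply toSubspace_injective
    rw [toSubspace_eq_rootSpaceSum hle, (haff _).mp hI, toSubspace_idealOfRoots]
  · rintro rfl
    refine ⟨?_, ?_⟩
    · rw [toSubspace_idealOfRoots]
      exact rootSpaceSum_le_nilradical hpos
    · rw [idealRoots_idealOfRoots]
      exact (haff _).mpr rfl
  · rw [idealRoots_idealOfRoots, hΦ]
  · rw [toSubspace_idealOfRoots, hΦ]
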